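/- Let $n,m\ge 0$, let $x=(x_0,\dots,x_n)$, $s=(s_1,\dots,s_m)$, and let $f\in\mathbb C\{x\}$ have an isolated singularity at $0$, i.e. $\mu:=\dim_{\mathbb C}\mathbb C\{x\}/(\partial_{x_0}f,\dots,\partial_{x_n}f)<\infty$. Let $F\in\mathbb C\{x,s\}$ be a deformation of $f$, i.e. $F|_{s=0}=f$. Let $\Omega^p$ be the module of germs at $0\in\mathbb C^{n+1}$ of holomorphic $p$-forms in $x$; below $d$ and $dF$ are taken relative to $s$ (in the variables $x$ only). Put $$\hat G_f=\frac{\Omega^{n+1}((u))}{(ud-df\wedge)\,\Omega^{n}((u))},\qquad \hat H''_f=\frac{\Omega^{n+1}[[u]]}{(ud-df\wedge)\,\Omega^{n}[[u]]},\qquad \Omega_f=\frac{\Omega^{n+1}}{df\wedge\Omega^{n}},$$ $$\hat G_{F,\hat S}=\frac{\Omega^{n+1}((u))[[s]]}{(ud-dF\wedge)\,\Omega^{n}((u))[[s]]},\qquad \hat H''_{F,\hat S}=\frac{\Omega^{n+1}[[u]][[s]]}{(ud-dF\wedge)\,\Omega^{n}[[u]][[s]]},\qquad \Omega_{F,\hat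 S}=\frac{\Omega^{n+1}[[s]]}{dF\wedge\Omega^{n}[[s]]},$$ and let $\hat G_{f,\hat S}$ be $\hat G_{F,\hat S}$ for the constant deformation $F=f$, so that $\hat G_{f,\hat S}=\hat G_f[[s]]$; let $\iota:\hat G_f\to\hat G_{f,\hat S}$ be the inclusion of the constant series. Setting $u=0$ gives projections $p_f:\hat H''_f\to\Omega_f$ and $p_{F,\hat S}:\hat H''_{F,\hat S}\to\Omega_{F,\hat S}$. The operator $\partial_{s_i}$ acts on $\hat G_{F,\hat S}$ by $\partial_{s_i}[\omega]=[\partial\omega/\partial s_i-u^{-1}(\partial F/\partial s_i)\,\omega]$, and multiplication by $e^{(F-f)/u}$, respectively $e^{(f-F)/u}$, defines $\Psi:\hat G_{f,\hat S}\to\hat G_{F,\hat S}$, respectively $\Phi:\hat G_{F,\hat S}\to\hat G_{f,\hat S}$. For a subspace $N\subset\hat G_f$ let $N[u^{-1}]=\sum_{k\ge0}u^{-k}N$, and let $\iota(N)[[s]]\subset\hat G_{f,\hat S}$ be the set of all series $\sum_\alpha\iota(g_\alpha)s^\alpha$ with all $g_\alpha\in N$. The canonical maps $\hat H''_f\to\hat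 G_f$ and $\hat H''_{F,\hat S}\to\hat G_{F,\hat S}$ are injective; regard them as inclusions. Call a $\mathbb C[[s]]$-linear section $\sigma_{\hat S}:\Omega_{F,\hat S}\to\hat H''_{F,\hat S}$ of $p_{F,\hat S}$, with image $I_{\hat S}$, *admissible* if $$\partial_{s_i}I_{\hat S}\subset I_{\hat S}+u^{-1}I_{\hat S}\qquad(1\le i\le m),$$ and let $I_0=I_{\hat S}|_{s=0}\subset\hat H''_f\subset\hat G_f$ be the restriction of its image to $s=0$. Then: 1. For every admissible section, $I_0$ is the image of a $\mathbb C$-linear section of $p_f$, and $$I_{\hat S}=\hat H''_{F,\hat S}\cap\Psi\bigl(\iota(I_0[u^{-1}])[[s]]\bigr).$$ 2. An admissible section is uniquely determined by $I_0$: two admissible sections with the same $I_0$ are equal. 3. For every $\mathbb C$-linear section of $p_f$, with image $I_0$, one has the direct sum decomposition $$\hat G_{f,\hat S}=\Phi(\hat H''_{F,\hat S})\oplus\iota\bigl(u^{-1}I_0[u^{-1}]\bigr)[[s]],$$ and there exists an admissible section whose image restricts to $I_0$ at $s=0$. -/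

import Mathlib

noncomputable section

namespace Brieskorn

/-! ### Convergent power series -/

/-- A power series `∑ a_ν x^ν` is convergent if `∑ |a_ν| r^|ν|` is finite for some `r > 0`. -/
def IsConv {ι : Type*} (f : MvPowerSeries ι ℂ) : Prop :=
  ∃ r : ℝ, 0 < r ∧ Summable fun ν : ι →₀ ℕ => ‖MvPowerSeries.coeff ν f‖ * r ^ ν.degree

theorem IsConv.mono {ι : Type*} {f : MvPowerSeries ι ℂ} {r r' : ℝ} (hr : 0 < r) (h : r ≤ r')
    (hf : Summable fun ν : ι →₀ ℕ => ‖MvPowerSeries.coeff ν f‖ * r' ^ ν.degree) :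
    Summable fun ν : ι →₀ ℕ => ‖MvPowerSeries.coeff ν f‖ * r ^ ν.degree :=
  Summable.of_nonneg_of_le (fun ν => by positivity) (fun ν =>
    mul_le_mul_of_nonneg_left (pow_le_pow_left₀ hr.le h _) (norm_nonneg _)) hf

theorem IsConv.add {ι : Type*} {f g : MvPowerSeries ι ℂ} (hf : IsConv f) (hg : IsConv g) :
    IsConv (f + g) := by
  obtain ⟨r, hr, hf⟩ := hf
  obtain ⟨r', hr', hg⟩ := hg
  have hm : 0 < min r r' := lt_min hr hr'
  refine ⟨min r r', hm, Summable.of_nonneg_of_le (fun ν => by positivity) (fun ν => ?_)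
    ((IsConv.mono hm (min_le_left _ _) hf).add (IsConv.mono hm (min_le_right _ _) hg))⟩
  rw [← add_mul, map_add]
  exact mul_le_mul_of_nonneg_right (norm_add_le _ _) (by positivity)

theorem summable_antidiagonal {A : Type*} [AddCommMonoid A] [Finset.HasAntidiagonal A]
    (a b : A → ℝ) (ha : ∀ ν, 0 ≤ a ν) (hb : ∀ ν, 0 ≤ b ν) (hsa : Summable a)
    (hsb : Summable b) :
    Summable fun ν => ∑ p ∈ Finset.HasAntidiagonal.antidiagonal ν, a p.1 * b p.2 :=
  summable_sum_mul_antidiagonal_of_summable_mul (Summable.mul_of_nonneg hsa hsb ha hb)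

theorem IsConv.mul {ι : Type*} {f g : MvPowerSeries ι ℂ} (hf : IsConv f) (hg : IsConv g) :
    IsConv (f * g) := by
  classical
  obtain ⟨r, hr, hf⟩ := hf
  obtain ⟨r', hr', hg⟩ := hg
  have hm : 0 < min r r' := lt_min hr hr'
  have hf' := IsConv.mono hm (min_le_left _ _) hf
  have hg' := IsConv.mono hm (min_le_right _ _) hg
  generalize min r r' = t at hm hf' hg'
  have hp := summable_antidiagonal _ _
    (fun ν => mul_nonneg (norm_nonneg _) (pow_nonneg hm.le _))
    (fun ν => mul_nonneg (norm_nonneg _) (pow_nonneg hm.le _)) hf' hg'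
  refine ⟨t, hm, Summable.of_nonneg_of_le
    (fun ν => mul_nonneg (norm_nonneg _) (pow_nonneg hm.le _)) (fun ν => ?_) hp⟩
  rw [MvPowerSeries.coeff_mul]
  refine (mul_le_mul_of_nonneg_right (norm_sum_le _ _) (pow_nonneg hm.le _)).trans (le_of_eq ?_)
  rw [Finset.sum_mul]
  refine Finset.sum_congr rfl fun p hp => ?_
  rw [← Finset.HasAntidiagonal.mem_antidiagonal.1 hp, map_add, pow_add, norm_mul]
  ring

/-- The ring `ℂ{x_i : i ∈ ι}` of convergent power series. -/
def Conv (ι : Type*) : Subalgebra ℂ (MvPowerSeries ι ℂ) where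
  carrier := {f | IsConv f}
  algebraMap_mem' c := by
    classical
    refine ⟨1, one_pos, summable_of_ne_finset_zero (s := {0}) fun ν hν => ?_⟩
    have hν' : ν ≠ 0 := by simpa using hν
    rw [← MvPowerSeries.c_eq_algebraMap, MvPowerSeries.coeff_C_of_ne_zero hν']
    simp
  add_mem' := IsConv.add
  mul_mem' := IsConv.mul

theorem pderiv_mem_Conv {ι : Type*} (i : ι) {f : MvPowerSeries ι ℂ} (hf : f ∈ Conv ι) :
    MvPowerSeries.pderiv ℂ i f ∈ Conv ι := by
  obtain ⟨r, hr, hf⟩ := hf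
  refine ⟨r / 2, by positivity, ?_⟩
  have hinj : Function.Injective fun ν : ι →₀ ℕ => ν + Finsupp.single i 1 :=
    fun a b h => add_right_cancel h
  refine Summable.of_nonneg_of_le (fun ν => by positivity) (fun ν => ?_)
    ((hf.comp_injective hinj).mul_left r⁻¹)
  have h1 : ((ν i : ℝ) + 1) ≤ 2 ^ ν.degree := by
    have h2 : ν i + 1 ≤ 2 ^ ν.degree :=
      lt_of_le_of_lt (Finsupp.le_degree i ν) Nat.lt_two_pow_self
    exact_mod_cast h2
  have h3 : ‖((ν i : ℂ) + 1)‖ = (ν i : ℝ) + 1 := by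
    have : ((ν i : ℂ) + 1) = ((ν i + 1 : ℕ) : ℂ) := by push_cast; rfl
    rw [this, Complex.norm_natCast]; push_cast; rfl
  simp only [Function.comp_apply, MvPowerSeries.coeff_pderiv, norm_mul, h3, map_add,
    Finsupp.degree_single, pow_succ, div_pow]
  have h4 : ((ν i : ℝ) + 1) * (r ^ ν.degree / 2 ^ ν.degree) ≤ r ^ ν.degree := by
    rw [mul_div_assoc', div_le_iff₀ (by positivity), mul_comm (r ^ ν.degree)]
    exact mul_le_mul_of_nonneg_right h1 (by positivity)
  calc _ = ‖MvPowerSeries.coeff (ν + Finsupp.single i 1) f‖ *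
        (((ν i : ℝ) + 1) * (r ^ ν.degree / 2 ^ ν.degree)) := by ring
    _ ≤ ‖MvPowerSeries.coeff (ν + Finsupp.single i 1) f‖ * r ^ ν.degree :=
        mul_le_mul_of_nonneg_left h4 (norm_nonneg _)
    _ = _ := by field_simp

/-- The partial derivative `∂/∂x_i` on `ℂ{x}`. -/
def pd {ι : Type*} (i : ι) : Derivation ℂ (Conv ι) (Conv ι) :=
  Derivation.mk'
    { toFun := fun f => ⟨MvPowerSeries.pderiv ℂ i f, pderiv_mem_Conv i f.2⟩
      map_add' := fun f g => Subtype.ext (by simp)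
      map_smul' := fun c f => Subtype.ext (by simp) }
    (fun f g => Subtype.ext (by simp))

/-- A convergent power series `F ∈ ℂ{x,s}`, expanded as a power series in `s` whose
coefficients are convergent power series in `x`. -/
def expand {ι τ : Type*} (F : Conv (ι ⊕ τ)) : MvPowerSeries τ (Conv ι) := fun α =>
  ⟨fun ν => MvPowerSeries.coeff (Finsupp.sumFinsuppEquivProdFinsupp.symm (ν, α))
      (F : MvPowerSeries (ι ⊕ τ) ℂ), by
    obtain ⟨r, hr, hF⟩ := F.2
    refine ⟨r, hr, ?_⟩
    have hinj : Function.Injective fun ν : ι →₀ ℕ =>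
        (Finsupp.sumFinsuppEquivProdFinsupp.symm (ν, α) : ι ⊕ τ →₀ ℕ) := fun a b h =>
      (Prod.mk.inj (Finsupp.sumFinsuppEquivProdFinsupp.symm.injective h)).1
    have hdeg : ∀ ν : ι →₀ ℕ, (Finsupp.sumFinsuppEquivProdFinsupp.symm (ν, α) :
        ι ⊕ τ →₀ ℕ).degree = ν.degree + α.degree := fun ν => by
      have : (Finsupp.sumFinsuppEquivProdFinsupp.symm (ν, α) : ι ⊕ τ →₀ ℕ) =
          Finsupp.mapDomain Sum.inl ν + Finsupp.mapDomain Sum.inr α := by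
        ext (a | b)
        · simp [Finsupp.mapDomain_apply Sum.inl_injective, Finsupp.mapDomain_of_notMem_range]
        · simp [Finsupp.mapDomain_apply Sum.inr_injective, Finsupp.mapDomain_of_notMem_range]
      rw [this, map_add]
      exact congrArg₂ _ (Finsupp.degree_mapDomain _ _) (Finsupp.degree_mapDomain _ _)
    refine ((hF.comp_injective hinj).mul_right (r ^ α.degree)⁻¹).congr fun ν => ?_
    simp only [Function.comp_apply, hdeg, pow_add]
    have : r ^ α.degree ≠ 0 := by positivity
    field_simp
    rfl⟩

/-! ### Coefficientwise derivations -/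

/-- The ring `B((u))` of Laurent series in `u`, as a `ℂ`-algebra (with the coefficientwise
action of `ℂ`). -/
def Laur (B : Type*) [CommRing B] : Type _ := LaurentSeries B

instance (B : Type*) [CommRing B] : CommRing (Laur B) := inferInstanceAs (CommRing (HahnSeries ℤ B))

instance (B : Type*) [CommRing B] [Algebra ℂ B] : Algebra ℂ (Laur B) :=
  (HahnSeries.instAlgebra : Algebra ℂ (HahnSeries ℤ B))

section Lift

variable {B : Type*} [CommRing B] [Algebra ℂ B]

/-- The coefficient of `u^k`. -/
def coeffU (k : ℤ) : Laur B →ₗ[ℂ] B where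
  toFun w := HahnSeries.coeff (Γ := ℤ) (R := B) w k
  map_add' _ _ := rfl
  map_smul' _ _ := rfl

@[ext]
theorem Laur.ext {v w : Laur B} (h : ∀ k, coeffU k v = coeffU k w) : v = w :=
  HahnSeries.ext (funext h)

/-- The element `u^k` of `B((u))`. -/
def upow (B : Type*) [CommRing B] (k : ℤ) : Laur B := HahnSeries.single (Γ := ℤ) (R := B) k 1

/-- The inclusion `B → B((u))`. -/
def constU (B : Type*) [CommRing B] : B →+* Laur B := (HahnSeries.C : B →+* HahnSeries ℤ B)

theorem coeffU_upow_mul (j k : ℤ) (w : Laur B) :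
    coeffU k (upow B j * w) = coeffU (k - j) w :=
  (HahnSeries.coeff_single_mul (Γ' := ℤ) (r := (1 : B)) (x := w)).trans (one_mul _)

theorem coeffU_constU_mul (k : ℤ) (b : B) (w : Laur B) :
    coeffU k (constU B b * w) = b * coeffU k w :=
  HahnSeries.coeff_single_zero_mul (Γ := ℤ) (r := b) (x := w)

theorem upow_mul_upow (B : Type*) [CommRing B] (j k : ℤ) : upow B j * upow B k = upow B (j + k) := by
  have h := HahnSeries.single_mul_single (Γ := ℤ) (a := j) (b := k) (r := (1 : B)) (s := 1)
  rw [mul_one] at h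
  exact h

/-- The derivation of `B((u))` which acts on coefficients by a derivation of `B`. -/
def liftU (d : Derivation ℂ B B) : Derivation ℂ (Laur B) (Laur B) :=
  Derivation.mk'
    { toFun := fun w => (HahnSeries.map (Γ := ℤ) (R := B) w d : HahnSeries ℤ B)
      map_add' := fun v w => HahnSeries.map_add (Γ := ℤ) (d : B →+ B)
      map_smul' := fun c w => HahnSeries.map_smul (Γ := ℤ) (d : B →ₗ[ℂ] B) }
    (fun v w => by
      change HahnSeries ℤ B at v w
      have hv : (HahnSeries.map v d).support ⊆ v.support := fun k hk h0 =>
        hk (by simp [HahnSeries.map_coeff, h0])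
      have hw : (HahnSeries.map w d).support ⊆ w.support := fun k hk h0 =>
        hk (by simp [HahnSeries.map_coeff, h0])
      change HahnSeries.map (v * w) d = v * HahnSeries.map w d + w * HahnSeries.map v d
      ext k
      simp only [HahnSeries.map_coeff, HahnSeries.coeff_add]
      rw [HahnSeries.coeff_mul, HahnSeries.coeff_mul_right' w.isPWO_support hw,
        mul_comm w (HahnSeries.map v d), HahnSeries.coeff_mul_left' v.isPWO_support hv,
        map_sum, ← Finset.sum_add_distrib]
      refine Finset.sum_congr rfl fun p _ => ?_
      simp only [Derivation.leibniz, smul_eq_mul, HahnSeries.map_coeff]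
      ring)

@[simp]
theorem coeffU_liftU (d : Derivation ℂ B B) (w : Laur B) (k : ℤ) :
    coeffU k (liftU d w) = d (coeffU k w) := rfl

theorem liftU_constU (d : Derivation ℂ B B) (b : B) : liftU d (constU B b) = constU B (d b) :=
  HahnSeries.map_single (Γ := ℤ) (a := 0) (r := b) ((d : B →+ B) : ZeroHom B B)

theorem liftU_upow (d : Derivation ℂ B B) (k : ℤ) : liftU d (upow B k) = 0 := by
  have h := HahnSeries.map_single (Γ := ℤ) (a := k) (r := (1 : B)) ((d : B →+ B) : ZeroHom B B)
  have h2 : ((d : B →+ B) : ZeroHom B B) 1 = 0 := d.map_one_eq_zero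
  rw [h2, HahnSeries.single_eq_zero] at h
  exact h

variable {τ : Type*}

/-- Apply a map to all coefficients of a power series. -/
def mapCoeff {A A' : Type*} [Semiring A] [Semiring A'] (g : A → A') (w : MvPowerSeries τ A) :
    MvPowerSeries τ A' :=
  fun α => g (MvPowerSeries.coeff α w)

@[simp]
theorem coeff_mapCoeff {A A' : Type*} [Semiring A] [Semiring A'] (g : A → A')
    (w : MvPowerSeries τ A) (α : τ →₀ ℕ) :
    MvPowerSeries.coeff α (mapCoeff g w) = g (MvPowerSeries.coeff α w) := rfl

theorem mapCoeff_leibniz (d : Derivation ℂ B B) (v w : MvPowerSeries τ B) :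
    mapCoeff d (v * w) = v * mapCoeff d w + w * mapCoeff d v := by
  classical
  ext α
  rw [map_add, mul_comm w]
  simp only [MvPowerSeries.coeff_mul, coeff_mapCoeff, map_sum]
  rw [← Finset.sum_add_distrib]
  refine Finset.sum_congr rfl fun p _ => ?_
  simp only [Derivation.leibniz, smul_eq_mul]
  ring

/-- The `ℂ[[s]]`-linear derivation of `B[[s]]` which acts on coefficients by a derivation
of `B`. -/
def liftS (d : Derivation ℂ B B) :
    Derivation (MvPowerSeries τ ℂ) (MvPowerSeries τ B) (MvPowerSeries τ B) :=
  Derivation.mk'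
    { toFun := mapCoeff d
      map_add' := fun v w => by ext α; simp
      map_smul' := fun c w => by
        rw [Algebra.smul_def, mapCoeff_leibniz, RingHom.id_apply, Algebra.smul_def]
        have : mapCoeff d (algebraMap (MvPowerSeries τ ℂ) (MvPowerSeries τ B) c) = 0 := by
          ext α
          rw [coeff_mapCoeff, MvPowerSeries.algebraMap_apply'']
          simp
        rw [this, mul_zero, add_zero] }
    (fun v w => mapCoeff_leibniz d v w)

@[simp]
theorem coeff_liftS (d : Derivation ℂ B B) (w : MvPowerSeries τ B) (α : τ →₀ ℕ) :
    MvPowerSeries.coeff α (liftS d w) = d (MvPowerSeries.coeff α w) := rfl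

/-- For `g ∈ B[[s]]` without constant term, the exponential `e^g = ∑_k g^k / k!`. Only the terms
with `k ≤ |α|` contribute to the coefficient of `s^α`. -/
def expS (g : MvPowerSeries τ B) : MvPowerSeries τ B := fun α =>
  ∑ k ∈ Finset.range (α.degree + 1), ((k.factorial : ℂ)⁻¹) • MvPowerSeries.coeff α (g ^ k)

theorem coeff_expS_eq {g : MvPowerSeries τ B} (hg : MvPowerSeries.constantCoeff g = 0)
    (α : τ →₀ ℕ) (N : ℕ) (hN : α.degree < N) :
    MvPowerSeries.coeff α (expS g) =
      MvPowerSeries.coeff α (∑ k ∈ Finset.range N, ((k.factorial : ℂ)⁻¹) • g ^ k) := by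
  have h : MvPowerSeries.coeff α (∑ k ∈ Finset.range N, ((k.factorial : ℂ)⁻¹) • g ^ k) =
      ∑ k ∈ Finset.range N, ((k.factorial : ℂ)⁻¹) • MvPowerSeries.coeff α (g ^ k) := by
    rw [map_sum]; rfl
  rw [h]
  refine Finset.sum_subset (Finset.range_subset_range.2 hN) fun k _ hk => ?_
  rw [MvPowerSeries.coeff_eq_zero_of_constantCoeff_nilpotent (m := 1) (by rw [hg]; simp)
    (by simp at hk; omega), smul_zero]

theorem liftS_expS (d : Derivation ℂ B B) {g : MvPowerSeries τ B}
    (hg : MvPowerSeries.constantCoeff g = 0) :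
    liftS d (expS g) = liftS d g * expS g := by
  classical
  have hT : ∀ N : ℕ, liftS d (∑ k ∈ Finset.range (N + 1), ((k.factorial : ℂ)⁻¹) • g ^ k) =
      liftS d g * ∑ k ∈ Finset.range N, ((k.factorial : ℂ)⁻¹) • g ^ k := by
    intro N
    have hs : ∀ (c : ℂ) (w : MvPowerSeries τ B), liftS d (c • w) = c • liftS d w := fun c w => by
      ext α
      exact d.map_smul c _
    rw [Finset.sum_range_succ', map_add, map_sum, Finset.mul_sum, hs, pow_zero,
      Derivation.map_one_eq_zero, smul_zero, add_zero]
    refine Finset.sum_congr rfl fun k _ => ?_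
    rw [hs, Derivation.leibniz_pow, Nat.add_sub_cancel, ← Nat.cast_smul_eq_nsmul ℂ, smul_smul,
      Nat.factorial_succ, smul_eq_mul, mul_comm (liftS d g), smul_mul_assoc]
    congr 1
    have : ((k : ℂ) + 1) ≠ 0 := Nat.cast_add_one_ne_zero k
    have h2 : (k.factorial : ℂ) ≠ 0 := Nat.cast_ne_zero.2 k.factorial_ne_zero
    push_cast
    field_simp
  ext α
  rw [coeff_liftS, coeff_expS_eq hg α (α.degree + 1 + 1) (by omega), ← coeff_liftS, hT,
    MvPowerSeries.coeff_mul, MvPowerSeries.coeff_mul]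
  refine Finset.sum_congr rfl fun p hp => ?_
  rw [coeff_expS_eq hg p.2 (α.degree + 1)]
  rw [← Finset.HasAntidiagonal.mem_antidiagonal.1 hp, map_add]
  omega

/-- The coefficientwise extension `A[[s]] → A'[[s]]` of a `ℂ`-linear map `A → A'`. -/
def mapCoeffLin {A A' : Type*} [CommRing A] [Algebra ℂ A] [CommRing A'] [Algebra ℂ A']
    (g : A →ₗ[ℂ] A') :
    MvPowerSeries τ A →ₗ[MvPowerSeries τ ℂ] MvPowerSeries τ A' where
  toFun := mapCoeff g
  map_add' v w := by ext α; simp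
  map_smul' c w := by
    classical
    ext α
    rw [coeff_mapCoeff, RingHom.id_apply, Algebra.smul_def, Algebra.smul_def,
      MvPowerSeries.coeff_mul, MvPowerSeries.coeff_mul, map_sum]
    refine Finset.sum_congr rfl fun p _ => ?_
    rw [MvPowerSeries.algebraMap_apply'', MvPowerSeries.algebraMap_apply'',
      MvPowerSeries.coeff_map, MvPowerSeries.coeff_map, coeff_mapCoeff, ← Algebra.smul_def,
      ← Algebra.smul_def, map_smul]

theorem mapCoeffLin_apply {A A' : Type*} [CommRing A] [Algebra ℂ A] [CommRing A'] [Algebra ℂ A']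
    (g : A →ₗ[ℂ] A') (w : MvPowerSeries τ A) : mapCoeffLin g w = mapCoeff g w := rfl

/-- The `ℂ[[s]]`-submodule `N[[s]]` of `A[[s]]`, for a `ℂ`-subspace `N` of `A`: the series with
all coefficients in `N`. -/
def seriesIn {A : Type*} [CommRing A] [Algebra ℂ A] (N : Submodule ℂ A) :
    Submodule (MvPowerSeries τ ℂ) (MvPowerSeries τ A) where
  carrier := {w | ∀ α, MvPowerSeries.coeff α w ∈ N}
  add_mem' hv hw α := by rw [map_add]; exact N.add_mem (hv α) (hw α)
  zero_mem' α := by rw [map_zero]; exact N.zero_mem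
  smul_mem' c w hw α := by
    classical
    rw [Algebra.smul_def, MvPowerSeries.coeff_mul]
    refine N.sum_mem fun p _ => ?_
    rw [MvPowerSeries.algebraMap_apply'', MvPowerSeries.coeff_map, ← Algebra.smul_def]
    exact N.smul_mem _ (hw _)

end Lift

/-! ### Twisted differentials and their top cohomology

A form of degree `n` in `x_0, …, x_n` is written `η = ∑_i η_i ι(∂_{x_i}) dx` with
`dx = dx_0 ∧ ⋯ ∧ dx_n`, i.e. `η_i` is the coefficient of
`(-1)^i dx_0 ∧ ⋯ (no dx_i) ⋯ ∧ dx_n`, and a form of degree `n + 1` is written `w dx`.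
Then `dη = (∑_i ∂_{x_i} η_i) dx` and `dg ∧ η = (∑_i (∂_{x_i} g) η_i) dx`. As there are no forms of
degree `n + 2`, the cohomology in degree `n + 1` is the cokernel of the last differential. -/

section TopCohomology

variable {ι R B : Type*} [Fintype ι] [CommRing R] [CommRing B] [Algebra R B]

/-- The last differential `η ↦ u dη - θ ∧ η`, where `θ = ∑_i g_i dx_i`. -/
def twistedD (D : ι → Derivation R B B) (u : B) (g : ι → B) : (ι → B) →ₗ[R] B where
  toFun η := ∑ i, (u * D i (η i) - g i * η i)
  map_add' η η' := by
    rw [← Finset.sum_add_distrib]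
    refine Finset.sum_congr rfl fun i _ => ?_
    simp only [Pi.add_apply, map_add]
    ring
  map_smul' c η := by
    rw [RingHom.id_apply, Finset.smul_sum]
    refine Finset.sum_congr rfl fun i _ => ?_
    rw [Pi.smul_apply, Derivation.map_smul, mul_smul_comm, mul_smul_comm, smul_sub]

/-- The map `η ↦ θ ∧ η`, where `θ = ∑_i g_i dx_i`. -/
def wedgeD (R : Type*) [CommRing R] [Algebra R B] (g : ι → B) : (ι → B) →ₗ[R] B where
  toFun η := ∑ i, g i * η i
  map_add' η η' := by
    rw [← Finset.sum_add_distrib]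
    exact Finset.sum_congr rfl fun i _ => by rw [Pi.add_apply, mul_add]
  map_smul' c η := by
    rw [RingHom.id_apply, Finset.smul_sum]
    exact Finset.sum_congr rfl fun i _ => by rw [Pi.smul_apply, mul_smul_comm]

/-- The top cohomology of the complex with last differential `T`. -/
abbrev TopCoh (T : (ι → B) →ₗ[R] B) : Type _ := B ⧸ LinearMap.range T

/-- The image under `T` of the forms with coefficients in `B₀`, as a submodule of `B₀`. -/
def subRange (T : (ι → B) →ₗ[R] B) (B₀ : Submodule R B) : Submodule R B₀ :=
  ((Submodule.pi Set.univ fun _ : ι => B₀).map T).comap B₀.subtype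

/-- The top cohomology of the subcomplex of forms with coefficients in `B₀`. -/
abbrev SubTopCoh (T : (ι → B) →ₗ[R] B) (B₀ : Submodule R B) : Type _ := B₀ ⧸ subRange T B₀

/-- The map on top cohomology induced by the inclusion of the subcomplex. -/
def incl (T : (ι → B) →ₗ[R] B) (B₀ : Submodule R B) : SubTopCoh T B₀ →ₗ[R] TopCoh T :=
  Submodule.mapQ _ _ B₀.subtype (by
    rintro w ⟨η, -, h⟩
    exact ⟨η, h⟩)

end TopCohomology

/-! ### The objects for a single germ -/

/-- `ℂ{x_0, …, x_n}`. -/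
abbrev Ox (n : ℕ) : Type := Conv (Fin (n + 1))

/-- `ℂ{x}((u))`. -/
abbrev OxU (n : ℕ) : Type := Laur (Ox n)

/-- `ℂ{x}[[s]]`. -/
abbrev OxS (n m : ℕ) : Type := MvPowerSeries (Fin m) (Ox n)

/-- `ℂ{x}((u))[[s]]`. -/
abbrev OxUS (n m : ℕ) : Type := MvPowerSeries (Fin m) (OxU n)

/-- `ℂ[[s]]`. -/
abbrev CS (m : ℕ) : Type := MvPowerSeries (Fin m) ℂ

/-- `ℂ{x}[[u]]` as a subspace of `ℂ{x}((u))`. -/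
def lattU (n : ℕ) : Submodule ℂ (OxU n) where
  carrier := {w | ∀ k : ℤ, k < 0 → coeffU k w = 0}
  add_mem' hv hw k hk := by rw [map_add, hv k hk, hw k hk, add_zero]
  zero_mem' k _ := map_zero _
  smul_mem' c w hw k hk := by rw [map_smul, hw k hk, smul_zero]

/-- `ℂ{x}[[u]][[s]] = ℂ{x}[[u,s]]` as a `ℂ[[s]]`-submodule of `ℂ{x}((u))[[s]]`. -/
def lattS (n m : ℕ) : Submodule (CS m) (OxUS n m) := seriesIn (lattU n)

section Fibre

variable {n : ℕ}

/-- The germ `f` has an isolated singularity at `0`, i.e. its Milnor number, the dimension of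
`ℂ{x}/(∂f)`, is finite. -/
def IsolatedSingularity (f : Ox n) : Prop :=
  Module.Finite ℂ (Ox n ⧸ Ideal.span (Set.range fun i : Fin (n + 1) => pd i f))

/-- The differential `u d - df ∧` on forms with coefficients in `ℂ{x}((u))`. -/
def diffU (f : Ox n) : (Fin (n + 1) → OxU n) →ₗ[ℂ] OxU n :=
  twistedD (fun i => liftU (pd i)) (upow _ 1) (fun i => constU _ (pd i f))

/-- The formal Gauss-Manin system `Ĝ_f`. -/
abbrev Gf (f : Ox n) : Type := TopCoh (diffU f)

/-- The formal Brieskorn lattice `Ĥ''_f`. -/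
abbrev Hf (f : Ox n) : Type := SubTopCoh (diffU f) (lattU n)

/-- The canonical map `Ĥ''_f → Ĝ_f`. -/
def jf (f : Ox n) : Hf f →ₗ[ℂ] Gf f := incl (diffU f) (lattU n)

/-- `Ω_f = Ω^{n+1} / df ∧ Ω^n`. -/
abbrev Omegaf (f : Ox n) : Type := TopCoh (wedgeD ℂ fun i => pd i f)

theorem coeffU_diffU (f : Ox n) (η : Fin (n + 1) → OxU n) (hη : ∀ i, η i ∈ lattU n) :
    coeffU 0 (diffU f η) = -wedgeD ℂ (fun i => pd i f) (fun i => coeffU 0 (η i)) := by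
  simp only [diffU, twistedD, wedgeD, LinearMap.coe_mk, AddHom.coe_mk, map_sum, map_sub]
  rw [← Finset.sum_neg_distrib]
  refine Finset.sum_congr rfl fun i _ => ?_
  have h0 : coeffU (0 - 1) (η i) = 0 := hη i _ (by norm_num)
  rw [coeffU_upow_mul, coeffU_constU_mul, coeffU_liftU, h0, map_zero, zero_sub]

/-- The canonical projection `Ĥ''_f → Ω_f`, given by `u = 0`. -/
def prf (f : Ox n) : Hf f →ₗ[ℂ] Omegaf f :=
  Submodule.mapQ _ _ ((coeffU 0).comp (lattU n).subtype) (by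
    rintro w ⟨η, hη, h⟩
    rw [Submodule.mem_comap, LinearMap.comp_apply, ← h,
      coeffU_diffU f η fun i => hη i trivial]
    exact Submodule.neg_mem _ ⟨_, rfl⟩)

/-- Multiplication by `u⁻¹` on `Ĝ_f`. -/
def uinvf (f : Ox n) : Gf f →ₗ[ℂ] Gf f :=
  Submodule.mapQ _ _ (LinearMap.mulLeft ℂ (upow (Ox n) (-1))) (by
    rintro _ ⟨η, rfl⟩
    refine ⟨fun i => upow _ (-1) * η i, ?_⟩
    simp only [diffU, twistedD, LinearMap.coe_mk, AddHom.coe_mk, LinearMap.mulLeft_apply,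
      Finset.mul_sum]
    refine Finset.sum_congr rfl fun i _ => ?_
    rw [Derivation.leibniz, liftU_upow, smul_zero, add_zero, smul_eq_mul]
    ring)

/-- `I[u⁻¹] = ∑_{k ≥ 0} u^{-k} I`, for a subspace `I` of `Ĝ_f`. -/
def adjoinUinv {f : Ox n} (I : Submodule ℂ (Gf f)) : Submodule ℂ (Gf f) :=
  ⨆ k : ℕ, I.map (uinvf f ^ k)

end Fibre

/-! ### The objects over the formal parameter space -/

section Family

variable {n m : ℕ}

/-- The inclusion `ℂ{x}[[s]] → ℂ{x}((u))[[s]]`. -/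
def emb : OxS n m →+* OxUS n m := MvPowerSeries.map (constU (Ox n))

/-- `u^k` as an element of `ℂ{x}((u))[[s]]`. -/
def upowS (n m : ℕ) (k : ℤ) : OxUS n m := MvPowerSeries.C (upow (Ox n) k)

theorem upowS_mul (j k : ℤ) : upowS n m j * upowS n m k = upowS n m (j + k) := by
  rw [upowS, upowS, upowS, ← map_mul, upow_mul_upow]

theorem upowS_one_mul_neg_one : upowS n m 1 * upowS n m (-1) = 1 := by
  rw [upowS_mul]
  exact map_one _

theorem liftS_upowS (d : Derivation ℂ (Ox n) (Ox n)) (k : ℤ) :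
    liftS (liftU d) (upowS n m k) = 0 := by
  classical
  ext1 α
  rw [coeff_liftS, upowS, MvPowerSeries.coeff_C]
  split_ifs
  · rw [liftU_upow, map_zero]
  · rw [map_zero, map_zero]

theorem liftS_emb (d : Derivation ℂ (Ox n) (Ox n)) (g : OxS n m) :
    liftS (liftU d) (emb g) = emb (liftS d g) := by
  ext1 α
  exact liftU_constU d _

theorem pderiv_emb (i : Fin m) (g : OxS n m) :
    MvPowerSeries.pderiv (OxU n) i (emb g) = emb (MvPowerSeries.pderiv (Ox n) i g) := by
  ext1 α
  rw [MvPowerSeries.coeff_pderiv, emb, MvPowerSeries.coeff_map, MvPowerSeries.coeff_map,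
    MvPowerSeries.coeff_pderiv, map_mul, map_add, map_natCast, map_one]

theorem pderiv_liftS {B : Type*} [CommRing B] [Algebra ℂ B] (d : Derivation ℂ B B) (i : Fin m)
    (w : MvPowerSeries (Fin m) B) :
    MvPowerSeries.pderiv B i (liftS d w) = liftS d (MvPowerSeries.pderiv B i w) := by
  ext1 α
  rw [MvPowerSeries.coeff_pderiv, coeff_liftS, coeff_liftS, MvPowerSeries.coeff_pderiv,
    Derivation.leibniz, map_add, Derivation.map_natCast, Derivation.map_one_eq_zero, add_zero,
    smul_zero, zero_add, smul_eq_mul, mul_comm]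

/-- The differential `u d - dF ∧` on relative forms with coefficients in `ℂ{x}((u))[[s]]`. -/
def diffS (F : OxS n m) : (Fin (n + 1) → OxUS n m) →ₗ[CS m] OxUS n m :=
  twistedD (fun i => liftS (liftU (pd i))) (upowS n m 1) (fun i => emb (liftS (pd i) F))

theorem diffS_apply (F : OxS n m) (η : Fin (n + 1) → OxUS n m) :
    diffS F η = ∑ i, (upowS n m 1 * liftS (liftU (pd i)) (η i) -
      emb (liftS (pd i) F) * η i) := rfl

/-- The formal Gauss-Manin system `Ĝ_{F,Ŝ}`. For `F = f` constant in `s` this is `Ĝ_{f,Ŝ}`. -/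
abbrev GS (F : OxS n m) : Type := TopCoh (diffS F)

/-- The formal Brieskorn lattice `Ĥ''_{F,Ŝ}`. -/
abbrev HS (F : OxS n m) : Type := SubTopCoh (diffS F) (lattS n m)

/-- The canonical map `Ĥ''_{F,Ŝ} → Ĝ_{F,Ŝ}`. -/
def jS (F : OxS n m) : HS F →ₗ[CS m] GS F := incl (diffS F) (lattS n m)

/-- `Ω_{F,Ŝ} = Ω^{n+1}[[s]] / dF ∧ Ω^n[[s]]`, with relative forms. -/
abbrev OmegaS (F : OxS n m) : Type := TopCoh (wedgeD (CS m) fun i => liftS (pd i) F)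

theorem mapCoeff_diffS (F : OxS n m) (η : Fin (n + 1) → OxUS n m)
    (hη : ∀ i, η i ∈ lattS n m) :
    mapCoeffLin (coeffU 0) (diffS F η) =
      -wedgeD (CS m) (fun i => liftS (pd i) F) (fun i => mapCoeffLin (coeffU 0) (η i)) := by
  classical
  rw [diffS_apply, map_sum]
  simp only [wedgeD, LinearMap.coe_mk, AddHom.coe_mk]
  rw [← Finset.sum_neg_distrib]
  refine Finset.sum_congr rfl fun i _ => ?_
  have h0 : ∀ α, coeffU (0 - 1) (MvPowerSeries.coeff α (η i)) = 0 :=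
    fun α => hη i α _ (by norm_num)
  ext1 α
  rw [map_sub, map_sub, map_neg, mapCoeffLin_apply, mapCoeffLin_apply, coeff_mapCoeff,
    coeff_mapCoeff, upowS, MvPowerSeries.coeff_C_mul, coeffU_upow_mul, coeff_liftS, coeffU_liftU,
    h0, map_zero, zero_sub, MvPowerSeries.coeff_mul, MvPowerSeries.coeff_mul, map_sum]
  refine congrArg _ (Finset.sum_congr rfl fun p _ => ?_)
  rw [emb, MvPowerSeries.coeff_map, coeffU_constU_mul, mapCoeffLin_apply, coeff_mapCoeff]

/-- The canonical projection `Ĥ''_{F,Ŝ} → Ω_{F,Ŝ}`, given by `u = 0`. -/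
def prS (F : OxS n m) : HS F →ₗ[CS m] OmegaS F :=
  Submodule.mapQ _ _ ((mapCoeffLin (coeffU 0)).comp (lattS n m).subtype) (by
    rintro w ⟨η, hη, h⟩
    rw [Submodule.mem_comap, LinearMap.comp_apply, ← h,
      mapCoeff_diffS F η fun i => hη i trivial]
    exact Submodule.neg_mem _ ⟨_, rfl⟩)

/-- Multiplication by `u⁻¹` on `Ĝ_{F,Ŝ}`. -/
def uinvS (F : OxS n m) : GS F →ₗ[CS m] GS F :=
  Submodule.mapQ _ _ (LinearMap.mulLeft (CS m) (upowS n m (-1))) (by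
    rintro _ ⟨η, rfl⟩
    refine ⟨fun i => upowS n m (-1) * η i, ?_⟩
    rw [diffS_apply, diffS_apply, LinearMap.mulLeft_apply, Finset.mul_sum]
    refine Finset.sum_congr rfl fun i _ => ?_
    rw [Derivation.leibniz, liftS_upowS, smul_zero, add_zero, smul_eq_mul]
    ring)

/-- The map `w ↦ ∂w/∂s_i - u⁻¹ (∂F/∂s_i) w` on `ℂ{x}((u))[[s]]`. -/
def nablaS (F : OxS n m) (i : Fin m) : OxUS n m →+ OxUS n m where
  toFun w := MvPowerSeries.pderiv (OxU n) i w -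
    upowS n m (-1) * emb (MvPowerSeries.pderiv (Ox n) i F) * w
  map_zero' := by rw [map_zero, mul_zero, sub_zero]
  map_add' v w := by rw [map_add, mul_add]; ring

/-- The action of `∂_{s_i}` on `Ĝ_{F,Ŝ}`. The class of `w` stands for `w δ(t - F)`, where
`∂_{s_i} δ(t - F) = - u⁻¹ (∂F/∂s_i) δ(t - F)`. -/
def dsS (F : OxS n m) (i : Fin m) : GS F →+ GS F :=
  QuotientAddGroup.map (LinearMap.range (diffS F)).toAddSubgroup
    (LinearMap.range (diffS F)).toAddSubgroup (nablaS F i) (by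
    rintro _ ⟨η, rfl⟩
    refine ⟨fun j => nablaS F i (η j), ?_⟩
    rw [diffS_apply, diffS_apply, map_sum]
    refine Finset.sum_congr rfl fun j _ => ?_
    have h := upowS_one_mul_neg_one (n := n) (m := m)
    simp only [nablaS, AddMonoidHom.coe_mk, ZeroHom.coe_mk, map_sub, Derivation.leibniz,
      liftS_upowS, liftS_emb, pderiv_emb, pderiv_liftS, smul_eq_mul, mul_zero, add_zero]
    rw [show MvPowerSeries.pderiv (OxU n) i (upowS n m 1) = 0 from MvPowerSeries.pderiv_C]
    linear_combination (-emb (liftS (pd j) (MvPowerSeries.pderiv (Ox n) i F)) * η j) * h)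

/-- The operator `e^{(F' - F)/u} : Ĝ_{F,Ŝ} → Ĝ_{F',Ŝ}`, for `F` and `F'` with the same
restriction to `s = 0`. -/
def expOp (F F' : OxS n m)
    (h : MvPowerSeries.constantCoeff F = MvPowerSeries.constantCoeff F') :
    GS F →ₗ[CS m] GS F' :=
  Submodule.mapQ _ _ (LinearMap.mulLeft (CS m) (expS (upowS n m (-1) * emb (F' - F)))) (by
    rintro _ ⟨η, rfl⟩
    have hg : MvPowerSeries.constantCoeff (upowS n m (-1) * emb (F' - F)) = 0 := by
      rw [map_mul, emb, MvPowerSeries.constantCoeff_map, map_sub, h, sub_self, map_zero,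
        mul_zero]
    refine ⟨fun i => expS (upowS n m (-1) * emb (F' - F)) * η i, ?_⟩
    rw [diffS_apply, diffS_apply, LinearMap.mulLeft_apply, Finset.mul_sum]
    refine Finset.sum_congr rfl fun i _ => ?_
    have h1 := upowS_one_mul_neg_one (n := n) (m := m)
    rw [Derivation.leibniz, liftS_expS _ hg, Derivation.leibniz, liftS_upowS, liftS_emb]
    simp only [smul_eq_mul, mul_zero, add_zero, map_sub]
    linear_combination (expS (upowS n m (-1) * (emb F' - emb F)) * η i *
      (emb (liftS (pd i) F') - emb (liftS (pd i) F))) * h1)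

/-- The reduction `ℂ[[s]] → ℂ` modulo the maximal ideal is surjective. -/
instance constantCoeff_surjective (τ : Type*) :
    RingHomSurjective (MvPowerSeries.constantCoeff : MvPowerSeries τ ℂ →+* ℂ) :=
  ⟨fun c => ⟨MvPowerSeries.C c, MvPowerSeries.constantCoeff_C c⟩⟩

/-- The restriction `ℂ{x}[[u]][[s]] → ℂ{x}[[u]]` to `s = 0`. -/
def restrLatt (n m : ℕ) :
    lattS n m →ₛₗ[(MvPowerSeries.constantCoeff : CS m →+* ℂ)] lattU n where
  toFun w := ⟨MvPowerSeries.constantCoeff w.1, w.2 0⟩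
  map_add' v w := Subtype.ext (map_add _ _ _)
  map_smul' c w := Subtype.ext (by
    change MvPowerSeries.constantCoeff (c • w.1) =
      MvPowerSeries.constantCoeff c • MvPowerSeries.constantCoeff w.1
    rw [Algebra.smul_def, map_mul, MvPowerSeries.algebraMap_apply'',
      MvPowerSeries.constantCoeff_map, ← Algebra.smul_def])

theorem constantCoeff_diffS {F : OxS n m} {f : Ox n} (h : MvPowerSeries.constantCoeff F = f)
    (η : Fin (n + 1) → OxUS n m) :
    MvPowerSeries.constantCoeff (diffS F η) =
      diffU f (fun i => MvPowerSeries.constantCoeff (η i)) := by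
  rw [diffS_apply, map_sum]
  refine Finset.sum_congr rfl fun i _ => ?_
  rw [map_sub, map_mul, map_mul, emb, MvPowerSeries.constantCoeff_map, upowS,
    MvPowerSeries.constantCoeff_C, ← h]
  rfl

/-- The restriction `Ĥ''_{F,Ŝ} → Ĥ''_f` to `s = 0`, where `F|_{s=0} = f`. -/
def restr {F : OxS n m} {f : Ox n} (h : MvPowerSeries.constantCoeff F = f) :
    HS F →ₛₗ[(MvPowerSeries.constantCoeff : CS m →+* ℂ)] Hf f :=
  Submodule.mapQ _ _ (restrLatt n m) (by
    rintro w ⟨η, hη, hw⟩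
    refine ⟨fun i => MvPowerSeries.constantCoeff (η i), fun i _ => hη i trivial 0, ?_⟩
    rw [← constantCoeff_diffS h, hw]
    rfl)

/-- For a subspace `N` of `Ĝ_f`, the submodule `ι(N)[[s]]` of `Ĝ_{f,Ŝ} = Ĝ_f[[s]]`: the classes
of the series `∑ w_α s^α` such that the class of every `w_α` lies in `N`. -/
def seriesG (m : ℕ) {f : Ox n} (N : Submodule ℂ (Gf f)) :
    Submodule (CS m) (GS (MvPowerSeries.C f : OxS n m)) :=
  (seriesIn (N.comap (Submodule.mkQ (LinearMap.range (diffU f))))).map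
    (Submodule.mkQ (LinearMap.range (diffS (MvPowerSeries.C f : OxS n m))))

/-- The image `I_Ŝ` of a section `σ`, as a submodule of `Ĝ_{F,Ŝ}`. -/
def imS {F : OxS n m} (σ : OmegaS F →ₗ[CS m] HS F) : Submodule (CS m) (GS F) :=
  (LinearMap.range σ).map (jS F)

/-- The restriction `I_0 = I_Ŝ|_{s=0}` of the image of `σ`, as a subspace of `Ĝ_f`. -/
def imZero {F : OxS n m} {f : Ox n} (h : MvPowerSeries.constantCoeff F = f)
    (σ : OmegaS F →ₗ[CS m] HS F) : Submodule ℂ (Gf f) :=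
  ((LinearMap.range σ).map (restr h)).map (jf f)

/-- `σ` is a section of the canonical projection `Ĥ''_{F,Ŝ} → Ω_{F,Ŝ}` whose image `I_Ŝ`
satisfies `∂_{s_i} I_Ŝ ⊆ I_Ŝ + u⁻¹ I_Ŝ` for all `i`. -/
def IsGoodSection {F : OxS n m} (σ : OmegaS F →ₗ[CS m] HS F) : Prop :=
  prS F ∘ₗ σ = LinearMap.id ∧
    ∀ i : Fin m, ∀ w ∈ imS σ, dsS F i w ∈ imS σ ⊔ (imS σ).map (uinvS F)

/-- The operator `Ψ = e^{(F - f)/u} : Ĝ_{f,Ŝ} → Ĝ_{F,Ŝ}`. -/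
def Psi {F : OxS n m} {f : Ox n} (h : MvPowerSeries.constantCoeff F = f) :
    GS (MvPowerSeries.C f : OxS n m) →ₗ[CS m] GS F :=
  expOp (MvPowerSeries.C f) F (by rw [MvPowerSeries.constantCoeff_C, h])

/-- The operator `Φ = e^{(f - F)/u} : Ĝ_{F,Ŝ} → Ĝ_{f,Ŝ}`. -/
def Phi {F : OxS n m} {f : Ox n} (h : MvPowerSeries.constantCoeff F = f) :
    GS F →ₗ[CS m] GS (MvPowerSeries.C f : OxS n m) :=
  expOp F (MvPowerSeries.C f) (by rw [MvPowerSeries.constantCoeff_C, h])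

end Family

end Brieskorn

end

open Brieskorn

/-! The operator `Phi` trivialises the deformation: it commutes with `u` and carries `∂_{s_i}` to
coefficientwise differentiation on `Ĝ_f[[s]]` (`expOp_dsS`, `coeffG_dsS`). If a section is
admissible, then `I_Ŝ[u⁻¹]` is stable under all `∂_{s_i}`. Up to nonzero factors, the Taylor
coefficients of `Phi z` are iterated `s`-derivatives of `z` restricted to `s = 0`. For `z` in
`I_Ŝ[u⁻¹]` they therefore lie in `I_0[u⁻¹]` (`IsGoodSection.coeffG_mem`). So `I_Ŝ` is contained in
`J = Ĥ''_F ∩ Ψ(I_0[u⁻¹][[s]])`. Both are complements of `u Ĥ''_F`, the kernel of the projection to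
`Ω_F`, so they are equal; this is the formula and gives uniqueness. Conversely, for any `I_0` the
submodule `J` is such a complement, hence the image of a section, and stability of `I_0[u⁻¹][[s]]`
under `∂_{s_i}` and `u⁻¹` makes that section admissible.

That `J` is a complement comes from the splitting `Ĝ_f = Ĥ''_f ⊕ u⁻¹ I_0[u⁻¹]`
(`IsFrame.eq_zero_of_mem`, `IsFrame.exists_add_mem`), lifted to power series by induction on the
exponent of `s`. The induction works because `e^{(f-F)/u}` has constant term 1 in `s`, so leading
coefficients are unchanged by `Phi`, and because leading coefficients of elements of `Ĥ''_F` lie in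
`Ĥ''_f` (`coeffG_mem_range_jf`).

The last fact rests on `exists_lattU_diffU_eq`: a form without pole in `u` which is exact has a
primitive without pole. Here the isolated singularity enters. The Jacobian ideal contains a power of
every coordinate, hence a regular sequence of length `n + 1`, so all relations between the `∂_{x_i}
f` are Koszul relations (`IsolatedSingularity.exists_skew`), and the lowest polar term of a
primitive can be removed. -/

/-! ### Exactness of Koszul complexes, in terms of alternating maps -/

namespace Koszul

open AlternatingMap RingTheory.Sequence
open scoped Pointwise

variable {A E N : Type*} [CommRing A] [AddCommGroup E] [Module A E] [AddCommGroup N] [Module A N]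

/-- The contraction with `f` is a differential, and the exterior multiplication with `a` is a
homotopy between zero and the multiplication with `a f`. -/
theorem curryLeft_alternatizeUncurryFin (a : E →ₗ[A] A) (f : E) {q : ℕ}
    (c : E [⋀^Fin (q + 1)]→ₗ[A] N) (hc : c.curryLeft f = 0) :
    (alternatizeUncurryFin (a.smulRight c)).curryLeft f = a f • c := by
  ext v
  rw [curryLeft_apply_apply, alternatizeUncurryFin_apply, Fin.sum_univ_succ]
  have h : ∀ i : Fin (q + 1), (-1) ^ ((i.succ : Fin (q + 2)) : ℕ) •
      (a.smulRight c) ((Matrix.vecCons f v : Fin (q + 2) → E) i.succ)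
        (i.succ.removeNth (Matrix.vecCons f v)) = 0 := by
    intro i
    have h1 : i.succ.removeNth (Matrix.vecCons f v : Fin (q + 2) → E) =
        Matrix.vecCons f (i.removeNth v) := by
      funext j
      refine Fin.cases ?_ (fun j => ?_) j
      · simp [Fin.removeNth]
      · simp [Fin.removeNth]
    have h2 : c (Matrix.vecCons f (i.removeNth v)) = 0 := by
      rw [← curryLeft_apply_apply, hc]; rfl
    rw [h1, LinearMap.smulRight_apply, AlternatingMap.smul_apply, h2, smul_zero, smul_zero]
  rw [Finset.sum_eq_zero fun i _ => h i]
  simp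

/-- An alternating map on a free module with values in a quotient can be lifted. -/
theorem exists_lift {N' : Type*} [AddCommGroup N'] [Module A N'] [Module.Free A E] {p : ℕ}
    (π : N →ₗ[A] N') (hπ : Function.Surjective π) (c : E [⋀^Fin p]→ₗ[A] N') :
    ∃ b : E [⋀^Fin p]→ₗ[A] N, π.compAlternatingMap b = c := by
  obtain ⟨g, hg⟩ := Module.projective_lifting_property π
    (exteriorPower.alternatingMapLinearEquiv c) hπ
  refine ⟨exteriorPower.alternatingMapLinearEquiv.symm g, ?_⟩
  ext v
  have := congrArg (fun h => h (exteriorPower.ιMulti A p v)) hg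
  simpa using this

/-- Division by a regular element is unique, so the pointwise quotients are automatically
multilinear and alternating. -/
theorem exists_smul_lift {g : A} (hg : IsSMulRegular N g) {p : ℕ} (w : E [⋀^Fin p]→ₗ[A] N)
    (hw : ∀ v, ∃ y, g • y = w v) : ∃ w' : E [⋀^Fin p]→ₗ[A] N, w = g • w' := by
  choose r hr using hw
  refine ⟨{ toFun := r, map_update_add' := ?_, map_update_smul' := ?_, map_eq_zero_of_eq' := ?_ },
    ?_⟩
  · intro _ v i x y
    apply hg
    simp only [smul_add, hr, w.map_update_add]
  · intro _ v i c x
    apply hg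
    simp only [smul_comm g c, hr, w.map_update_smul]
  · intro v i j h hij
    apply hg
    simp only [smul_zero, hr, w.map_eq_zero_of_eq v h hij]
  · ext v
    exact (hr v).symm

/-- One regular element is traded for one degree. The form `a ∧ c` has contraction `a(f) c`, so it
is a cycle modulo `a(f)`. By `H` it is a boundary `ι_f b` modulo `a(f)`, and the difference divided
by `a(f)` is a primitive of `c`. -/
theorem exists_curryLeft_eq_of_quotSMulTop [Module.Free A E] (f : E) (a : E →ₗ[A] A)
    (ha : IsSMulRegular N (a f)) {q : ℕ}
    (H : ∀ c : E [⋀^Fin (q + 1 + 1)]→ₗ[A] QuotSMulTop (a f) N, c.curryLeft f = 0 →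
      ∃ b : E [⋀^Fin (q + 1 + 1 + 1)]→ₗ[A] QuotSMulTop (a f) N, b.curryLeft f = c)
    (c : E [⋀^Fin (q + 1)]→ₗ[A] N) (hc : c.curryLeft f = 0) :
    ∃ b : E [⋀^Fin (q + 1 + 1)]→ₗ[A] N, b.curryLeft f = c := by
  set w := alternatizeUncurryFin (a.smulRight c) with hw
  have hwc : w.curryLeft f = a f • c := curryLeft_alternatizeUncurryFin a f c hc
  let π : N →ₗ[A] QuotSMulTop (a f) N := Submodule.mkQ _
  obtain ⟨b', hb'⟩ := H (π.compAlternatingMap w) (by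
    rw [curryLeft_compAlternatingMap, hwc]
    ext v
    refine (Submodule.Quotient.mk_eq_zero _).2 ?_
    exact Submodule.smul_mem_pointwise_smul _ _ _ trivial)
  obtain ⟨b, rfl⟩ := exists_lift π (Submodule.mkQ_surjective _) b'
  obtain ⟨w', hw'⟩ := exists_smul_lift ha (w - b.curryLeft f) (fun v => by
    have h : π (w v - b.curryLeft f v) = 0 := by
      have := congrArg (fun h => h v) hb'
      rw [map_sub, sub_eq_zero]
      exact this.symm
    obtain ⟨y, -, hy⟩ := (Submodule.Quotient.mk_eq_zero _).1 h
    exact ⟨y, hy⟩)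
  refine ⟨w', ?_⟩
  -- Contract `a ∧ c - ι_f b = a(f) w'` with `f`; the term with `b` disappears since `ι_f ι_f = 0`.
  -- Then `a(f)` is cancelled.
  have h1 : a f • w'.curryLeft f = a f • c := by
    have : (a f • w').curryLeft f = a f • c := by
      rw [← hw', sub_eq_add_neg, curryLeft_add, LinearMap.add_apply, hwc,
        show (-(b.curryLeft f)) = (-1 : A) • b.curryLeft f by simp, curryLeft_smul]
      simp
    rw [← this, curryLeft_smul]; rfl
  ext v
  exact ha (by simpa using congrArg (fun h => h v) h1)

/-- If the ideal of the values `a f` contains a regular sequence of length `r`, the Koszul complex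
of `f` is exact in the degrees `p` with `p + r > rank E` and `p ≥ 1`. -/
theorem exists_curryLeft_eq {n : ℕ} (b : Module.Basis (Fin n) A E) (f : E) (rs : List (E →ₗ[A] A))
    {N : Type*} [AddCommGroup N] [Module A N]
    (hrs : IsWeaklyRegular N (rs.map fun a => a f)) {q : ℕ} (hq : n ≤ q + rs.length)
    (c : E [⋀^Fin (q + 1)]→ₗ[A] N) (hc : c.curryLeft f = 0) :
    ∃ b : E [⋀^Fin (q + 1 + 1)]→ₗ[A] N, b.curryLeft f = c := by
  have : Module.Free A E := Module.Free.of_basis b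
  induction rs generalizing q N with
  | nil =>
    refine ⟨0, ?_⟩
    -- The degree `q + 1` exceeds the rank `n`, so no tuple of distinct basis vectors is left to
    -- test.
    have : c = 0 := b.ext_alternating fun v hv => by
      have := Fintype.card_le_of_injective v hv
      simp at this hq
      omega
    rw [this]; simp
  | cons a rs ih =>
    rw [List.map_cons, isWeaklyRegular_cons_iff] at hrs
    refine exists_curryLeft_eq_of_quotSMulTop f a hrs.1 (fun c hc => ?_) c hc
    exact ih hrs.2 (by simp at hq; omega) c hc

/-- If the ideal `(f_0, …, f_n)` contains a regular sequence of length `n`, every relation between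
the `f_i` is a combination of the trivial ones. -/
theorem exists_skew_of_sum_eq_zero {n : ℕ} (f : Fin (n + 1) → A) (rs : List A)
    (hrs : IsWeaklyRegular A rs) (hmem : ∀ r ∈ rs, r ∈ Ideal.span (Set.range f))
    (hlen : rs.length = n + 1) (η : Fin (n + 1) → A) (h : ∑ i, f i * η i = 0) :
    ∃ b : Fin (n + 1) → Fin (n + 1) → A, (∀ i j, b i j = -b j i) ∧
      ∀ j, ∑ i, f i * b i j = η j := by
  have hex : ∀ r ∈ rs, ∃ a : (Fin (n + 1) → A) →ₗ[A] A, a f = r := by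
    intro r hr
    obtain ⟨a, ha⟩ := (Ideal.mem_span_range_iff_exists_fun).1 (hmem r hr)
    refine ⟨∑ i, a i • LinearMap.proj i, ?_⟩
    simpa using ha
  obtain ⟨rs, rfl⟩ : ∃ rs' : List ((Fin (n + 1) → A) →ₗ[A] A), rs'.map (fun a => a f) = rs := by
    clear hrs hmem hlen
    induction rs with
    | nil => exact ⟨[], rfl⟩
    | cons r rs ih =>
      obtain ⟨l, hl⟩ := ih fun r hr => hex r (List.mem_cons_of_mem _ hr)
      obtain ⟨a, ha⟩ := hex r List.mem_cons_self
      exact ⟨a :: l, by simp [hl, ha]⟩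
  -- The relation `η` is viewed as an alternating 1-form, whose contraction with `f` is `∑ η_i f_i =
  -- 0`. A 2-form with contraction `η` has as its matrix the required skew family.
  let φ : (Fin (n + 1) → A) →ₗ[A] A := ∑ i, η i • LinearMap.proj i
  have hφ : ∀ v, φ v = ∑ i, η i * v i := fun v => by simp [φ]
  have : Subsingleton (Fin (0 + 1)) := inferInstanceAs (Subsingleton (Fin 1))
  let c : (Fin (n + 1) → A) [⋀^Fin (0 + 1)]→ₗ[A] A :=
    AlternatingMap.ofSubsingleton A _ A (0 : Fin (0 + 1)) φ
  have hc : ∀ v, c v = φ (v 0) := fun v => rfl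
  obtain ⟨b, hb⟩ := exists_curryLeft_eq (Pi.basisFun A (Fin (n + 1))) f rs hrs (q := 0)
    (by simp at hlen; omega) c (by
      ext v
      rw [curryLeft_apply_apply, hc, hφ, AlternatingMap.zero_apply, ← h]
      exact Finset.sum_congr rfl fun i _ => mul_comm _ _)
  refine ⟨fun i j => b ![Pi.single i 1, Pi.single j 1], fun i j => ?_, fun j => ?_⟩
  · have := b.map_swap ![Pi.single i 1, Pi.single j 1] (i := 0) (j := 1) (by decide)
    rw [← neg_eq_iff_eq_neg, ← this]
    congr 1
    funext k
    fin_cases k <;> rfl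
  · have h1 := congrArg (fun h => h ![Pi.single j 1]) hb
    simp only [curryLeft_apply_apply, hc, hφ] at h1
    have h2 : ∑ i, η i * (Pi.single j 1 : Fin (n + 1) → A) i = η j := by
      simp [Pi.single_apply]
    have h3 : (![Pi.single j 1] : Fin 1 → Fin (n + 1) → A) 0 = Pi.single j 1 := rfl
    rw [h3, h2] at h1
    rw [← h1]
    have h4 : f = ∑ i, f i • (Pi.single i 1 : Fin (n + 1) → A) := by
      funext k; simp [Finset.sum_apply, Pi.single_apply]
    let L : (Fin (n + 1) → A) →ₗ[A] A :=
      { toFun := fun x => b.curryLeft x ![Pi.single j 1]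
        map_add' := fun x y => by rw [map_add]; rfl
        map_smul' := fun x y => by rw [map_smul]; rfl }
    have h5 : L f = ∑ i, f i * L (Pi.single i 1) := by
      conv_lhs => rw [h4]
      simp [map_sum]
    exact h5.symm
end Koszul

/-! ### Finite colength ideals of `ℂ{x}` -/

namespace Brieskorn

open MvPowerSeries in
theorem isConv_of_finite {ι : Type*} {f : MvPowerSeries ι ℂ} (s : Finset (ι →₀ ℕ))
    (h : ∀ ν ∉ s, coeff ν f = 0) : IsConv f :=
  ⟨1, one_pos, summable_of_ne_finset_zero (s := s) fun ν hν => by rw [h ν hν]; simp⟩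

/-- The coordinate function `x_i`. -/
noncomputable def convX {ι : Type*} (i : ι) : Conv ι :=
  ⟨MvPowerSeries.X i, isConv_of_finite {Finsupp.single i 1} fun ν hν => by
    classical
    rw [MvPowerSeries.coeff_X, if_neg (by simpa using hν)]⟩

theorem coe_convX_pow {ι : Type*} (i : ι) (N : ℕ) :
    ((convX i ^ N : Conv ι) : MvPowerSeries ι ℂ) =
      MvPowerSeries.monomial (Finsupp.single i N) 1 := by
  rw [← MvPowerSeries.X_pow_eq]; rfl

theorem isUnit_convX_sub {ι : Type*} (i : ι) {a : ℂ} (ha : a ≠ 0) :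
    IsUnit (convX i - algebraMap ℂ (Conv ι) a) := by
  classical
  -- This is the geometric series `∑ a^{-(k+1)} x_i^k`, the inverse of `a - x_i`. At radius `‖a‖ /
  -- 2` it is dominated by `‖a‖⁻¹ ∑ 2^{-k}`.
  let g : MvPowerSeries ι ℂ := fun ν => if ν = Finsupp.single i (ν i) then a⁻¹ ^ (ν i + 1) else 0
  have hgc : ∀ ν, MvPowerSeries.coeff ν g =
    if ν = Finsupp.single i (ν i) then a⁻¹ ^ (ν i + 1) else 0 := fun ν => rfl
  have hg : IsConv g := by
    have hpos : 0 < ‖a‖ := norm_pos_iff.2 ha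
    refine ⟨‖a‖ / 2, by positivity, ?_⟩
    have hinj : Function.Injective fun k : ℕ => Finsupp.single i k := Finsupp.single_injective i
    refine (hinj.summable_iff fun ν hν => ?_).1 ?_
    · rw [hgc, if_neg fun h => hν ⟨_, h.symm⟩]; simp
    · refine ((summable_geometric_two).mul_left ‖a‖⁻¹).congr fun k => ?_
      simp only [Function.comp_apply, hgc, Finsupp.single_eq_same, eq_self, if_true, norm_mul, norm_pow, norm_inv,
        Finsupp.degree_single, div_pow, pow_succ]
      field_simp
      rw [← mul_pow, one_div_mul_cancel hpos.ne']
  have hmul : (MvPowerSeries.X i - MvPowerSeries.C a) * g = -1 := by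
    ext ν
    rw [sub_mul, map_sub, MvPowerSeries.coeff_C_mul, MvPowerSeries.X_def,
      MvPowerSeries.coeff_monomial_mul, map_neg, MvPowerSeries.coeff_one, hgc, hgc, one_mul]
    by_cases h0 : ν = 0
    · subst h0
      simp [ha]
    · rw [if_neg h0]
      by_cases h1 : Finsupp.single i 1 ≤ ν
      · have h1' : 1 ≤ ν i := by simpa using h1 i
        have h3 : (ν - Finsupp.single i 1 : ι →₀ ℕ) i + 1 = ν i := by
          rw [Finsupp.tsub_apply, Finsupp.single_eq_same]; omega
        have h2 : (ν - Finsupp.single i 1 = Finsupp.single i ((ν - Finsupp.single i 1 : ι →₀ ℕ) i)) ↔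
            ν = Finsupp.single i (ν i) := by
          rw [tsub_eq_iff_eq_add_of_le h1, ← Finsupp.single_add, h3]
        rw [if_pos h1, h3]
        simp only [h2]
        split_ifs
        · rw [pow_succ]; field_simp; ring
        · ring
      · rw [if_neg h1, if_neg]
        · ring
        · intro h
          apply h1
          rw [h]
          refine Finsupp.single_le_single.2 ?_
          by_contra h4
          apply h0
          rw [h, show ν i = 0 by omega, Finsupp.single_zero]
  refine IsUnit.of_mul_eq_one (-⟨g, hg⟩) (Subtype.ext ?_)
  change (MvPowerSeries.X i - algebraMap ℂ (MvPowerSeries ι ℂ) a) * -g = 1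
  rw [← MvPowerSeries.c_eq_algebraMap, mul_neg, hmul, neg_neg]

/-- An ideal of finite codimension in `ℂ{x}` contains a power of every coordinate. -/
theorem exists_convX_pow_mem {ι : Type*} (I : Ideal (Conv ι)) [Module.Finite ℂ (Conv ι ⧸ I)]
    (i : ι) : ∃ N, convX i ^ N ∈ I := by
  have hint : IsIntegral ℂ (Ideal.Quotient.mk I (convX i)) := IsIntegral.of_finite ℂ _
  obtain ⟨p, hp, hpx⟩ := hint
  -- Split off the root 0: `p = X^N q` with `q(0) ≠ 0`. Over `ℂ`, `q(x_i)` is a nonzero constant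
  -- times factors `x_i - a` with `a ≠ 0`, hence a unit, and `p(x_i) ∈ I` gives `x_i^N ∈ I`.
  obtain ⟨q, hq, hq0⟩ := Polynomial.exists_eq_pow_rootMultiplicity_mul_and_not_dvd p hp.ne_zero 0
  rw [map_zero, sub_zero] at hq hq0
  have hu : IsUnit (Polynomial.aeval (convX i) q) := by
    by_contra hn
    have hs := IsAlgClosed.splits q
    rw [hs.eq_prod_roots] at hn
    obtain ⟨a, ha, hna⟩ : ∃ a ∈ q.roots, ¬ IsUnit (convX i - algebraMap ℂ (Conv ι) a) := by
      by_contra! hall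
      apply hn
      rw [map_mul, Polynomial.aeval_C]
      refine IsUnit.mul ((IsUnit.mk0 _ ?_).map _) ?_
      · rw [Ne, Polynomial.leadingCoeff_eq_zero]
        rintro rfl
        exact hq0 (dvd_zero _)
      · rw [map_multiset_prod, Multiset.map_map]
        refine Multiset.prod_induction IsUnit _ (fun _ _ => IsUnit.mul) isUnit_one ?_
        intro y hy
        obtain ⟨a, ha, rfl⟩ := Multiset.mem_map.1 hy
        simpa using hall a ha
    refine hna (isUnit_convX_sub i ?_)
    rintro rfl
    rw [Polynomial.mem_roots', Polynomial.IsRoot, ← Polynomial.coeff_zero_eq_eval_zero,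
      ← Polynomial.X_dvd_iff] at ha
    exact hq0 ha.2
  refine ⟨p.rootMultiplicity 0, ?_⟩
  have hmem : Polynomial.aeval (convX i) p ∈ I := by
    rw [← Ideal.Quotient.eq_zero_iff_mem, ← hpx]
    exact (Polynomial.aeval_algHom_apply (Ideal.Quotient.mkₐ ℂ I) (convX i) p).symm
  rw [hq, map_mul, map_pow, Polynomial.aeval_X] at hmem
  exact (Ideal.mul_unit_mem_iff_mem I hu).1 hmem

/-- The ideal `(x_j^N : j ∈ T)` in terms of coefficients. -/
theorem mem_span_convX_pow {ι : Type*} (N : ℕ) (T : Finset ι) (f : Conv ι) :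
    f ∈ Ideal.span ((fun j => convX j ^ N) '' (T : Set ι)) ↔
      ∀ ν : ι →₀ ℕ, (∀ j ∈ T, ν j < N) → MvPowerSeries.coeff ν (f : MvPowerSeries ι ℂ) = 0 := by
  classical
  constructor
  · intro hf
    let J : Ideal (Conv ι) :=
      { carrier := {f | ∀ ν : ι →₀ ℕ, (∀ j ∈ T, ν j < N) →
          MvPowerSeries.coeff ν (f : MvPowerSeries ι ℂ) = 0}
        add_mem' := fun {a b} ha hb ν hν => by
          change MvPowerSeries.coeff ν ((a : MvPowerSeries ι ℂ) + (b : MvPowerSeries ι ℂ)) = 0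
          rw [map_add, ha ν hν, hb ν hν, add_zero]
        zero_mem' := fun ν _ => map_zero _
        smul_mem' := fun a b hb ν hν => by
          change MvPowerSeries.coeff ν ((a : MvPowerSeries ι ℂ) * (b : MvPowerSeries ι ℂ)) = 0
          rw [MvPowerSeries.coeff_mul]
          refine Finset.sum_eq_zero fun p hp => ?_
          rw [hb p.2 fun j hj => ?_, mul_zero]
          refine lt_of_le_of_lt ?_ (hν j hj)
          rw [← Finset.HasAntidiagonal.mem_antidiagonal.1 hp]
          simp }
    have hle : Ideal.span ((fun j => convX j ^ N) '' (T : Set ι)) ≤ J := by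
      rw [Ideal.span_le]
      rintro _ ⟨j, hj, rfl⟩ ν hν
      change MvPowerSeries.coeff ν ((convX j ^ N : Conv ι) : MvPowerSeries ι ℂ) = 0
      rw [coe_convX_pow, MvPowerSeries.coeff_monomial, if_neg]
      rintro rfl
      have := hν j hj
      simp at this
    exact hle hf
  · induction T using Finset.induction_on generalizing f with
    | empty =>
      intro h
      have : f = 0 := Subtype.ext (MvPowerSeries.ext fun ν => h ν (by simp))
      rw [this]
      exact Ideal.zero_mem _
    | insert j T hj ih =>
      intro h
      -- The part of `f` made of the monomials divisible by `x_j^N` is `x_j^N g`. What remains has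
      -- only monomials with exponent of `x_j` below `N`, so the condition on `T` alone suffices for
      -- it.
      let g : MvPowerSeries ι ℂ := fun ν =>
        MvPowerSeries.coeff (ν + Finsupp.single j N) (f : MvPowerSeries ι ℂ)
      have hg : IsConv g := by
        obtain ⟨r, hr, hf⟩ := f.2
        refine ⟨r, hr, ?_⟩
        have hinj : Function.Injective fun ν : ι →₀ ℕ => ν + Finsupp.single j N :=
          fun a b h => add_right_cancel h
        refine ((hf.comp_injective hinj).mul_right (r ^ N)⁻¹).congr fun ν => ?_
        simp only [Function.comp_apply, map_add, Finsupp.degree_single, pow_add]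
        have : r ^ N ≠ 0 := by positivity
        field_simp
        rfl
      let g' : Conv ι := ⟨g, hg⟩
      have h1 : f - convX j ^ N * g' ∈ Ideal.span ((fun j => convX j ^ N) '' (T : Set ι)) := by
        refine ih _ fun ν hν => ?_
        change MvPowerSeries.coeff ν ((f : MvPowerSeries ι ℂ) -
          ((convX j ^ N : Conv ι) : MvPowerSeries ι ℂ) * g) = 0
        rw [map_sub, coe_convX_pow, MvPowerSeries.coeff_monomial_mul, one_mul]
        split_ifs with hle
        · change _ - MvPowerSeries.coeff (ν - _ + _) _ = _
          rw [tsub_add_cancel_of_le hle, sub_self]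
        · rw [sub_zero]
          refine h ν fun k hk => ?_
          rcases Finset.mem_insert.1 hk with rfl | hk
          · rwa [Finsupp.single_le_iff, not_le] at hle
          · exact hν k hk
      have h2 : f = convX j ^ N * g' + (f - convX j ^ N * g') := by ring
      rw [h2]
      refine Ideal.add_mem _ (Ideal.mul_mem_right _ _ (Ideal.subset_span ⟨j, by simp, rfl⟩)) ?_
      exact Ideal.span_mono (Set.image_mono (by simp)) h1

/-- Membership in `(x_j^N : j < k)` is a condition on the exponents of the `x_j` with `j < k`.
Multiplication by `x_k^N` shifts only the exponent of `x_k`, so it is injective modulo this ideal.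
-/
theorem isWeaklyRegular_convX_pow (n N : ℕ) :
    RingTheory.Sequence.IsWeaklyRegular (Conv (Fin n)) (List.ofFn fun i : Fin n => convX i ^ N) := by
  classical
  refine ⟨fun k hk => ?_⟩
  have hk' : k < n := by simpa using hk
  have hI : Ideal.ofList ((List.ofFn fun i : Fin n => convX i ^ N).take k) =
      Ideal.span ((fun j => convX j ^ N) ''
        ((Finset.univ.filter fun j : Fin n => (j : ℕ) < k : Finset (Fin n)) : Set (Fin n))) := by
    rw [Ideal.ofList]
    congr 1
    ext r
    simp only [Set.mem_ofPred_eq, Set.mem_image, Finset.coe_filter, Finset.mem_univ, true_and,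
      List.mem_take_iff_getElem, List.getElem_ofFn, List.length_ofFn]
    constructor
    · rintro ⟨i, hi, rfl⟩
      exact ⟨⟨i, by omega⟩, by simp; omega, rfl⟩
    · rintro ⟨j, hj, rfl⟩
      exact ⟨j, by simp; omega, rfl⟩
  rw [List.getElem_ofFn, isSMulRegular_iff_right_eq_zero_of_smul]
  intro x
  induction x using Submodule.Quotient.induction_on with
  | _ w =>
  rw [← Submodule.Quotient.mk_smul, Submodule.Quotient.mk_eq_zero, Submodule.Quotient.mk_eq_zero,
    smul_eq_mul, smul_eq_mul, Ideal.mul_top, hI, mem_span_convX_pow, mem_span_convX_pow]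
  intro h ν hν
  have := h (Finsupp.single ⟨k, hk'⟩ N + ν) (fun j hj => by
    have hj' : (j : ℕ) < k := by simpa using hj
    have hne : (⟨k, hk'⟩ : Fin n) ≠ j := by
      rintro rfl
      simp at hj'
    rw [Finsupp.add_apply, Finsupp.single_eq_of_ne hne.symm, zero_add]
    exact hν j hj)
  rw [show ((convX (⟨k, hk'⟩ : Fin n) ^ N * w : Conv (Fin n)) : MvPowerSeries (Fin n) ℂ) =
    ((convX ⟨k, hk'⟩ ^ N : Conv (Fin n)) : MvPowerSeries (Fin n) ℂ) * w from rfl, coe_convX_pow,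
    MvPowerSeries.coeff_add_monomial_mul, one_mul] at this
  exact this

/-- For an isolated singularity, every relation between the partial derivatives is a combination
of the trivial ones. -/
theorem IsolatedSingularity.exists_skew {n : ℕ} {f : Ox n} (hf : IsolatedSingularity f)
    (η : Fin (n + 1) → Ox n) (h : ∑ i, pd i f * η i = 0) :
    ∃ b : Fin (n + 1) → Fin (n + 1) → Ox n, (∀ i j, b i j = -b j i) ∧
      ∀ j, ∑ i, pd i f * b i j = η j := by
  have : Module.Finite ℂ (Ox n ⧸ Ideal.span (Set.range fun i : Fin (n + 1) => pd i f)) := hf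
  choose N hN using exists_convX_pow_mem (Ideal.span (Set.range fun i : Fin (n + 1) => pd i f))
  -- The sum of the exponents `N i` is a common exponent that works for every coordinate.
  refine Koszul.exists_skew_of_sum_eq_zero _ _
    (isWeaklyRegular_convX_pow (n + 1) (∑ i, N i)) ?_ (by simp) η h
  intro r hr
  obtain ⟨i, rfl⟩ := List.mem_ofFn.1 hr
  exact Ideal.pow_mem_of_pow_mem _ (hN i) (Finset.single_le_sum (fun _ _ => Nat.zero_le _)
    (Finset.mem_univ i))

end Brieskorn

/-! ### Lattices and complements -/

namespace LatticeDecomposition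

variable {K V : Type*} [CommRing K] [AddCommGroup V] [Module K V]

/-- A lattice `H` in a space with an invertible operator `u` (with inverse `v`), together with a
complement `I` of `u H` in `H`. -/
structure IsFrame (u v : V →ₗ[K] V) (H I : Submodule K V) : Prop where
  vu : ∀ x, v (u x) = x
  uv : ∀ x, u (v x) = x
  le : I ≤ H
  map_mem : ∀ x ∈ H, u x ∈ H
  exists_add : ∀ x ∈ H, ∃ a ∈ I, ∃ y ∈ H, x = a + u y
  eq_zero : ∀ y ∈ H, u y ∈ I → y = 0
  exists_pow_mem : ∀ x, ∃ k : ℕ, (u ^ k) x ∈ H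

/-- The submodule `I[v] = ∑_{k ≥ 0} v^k I`. -/
def adjoin (v : V →ₗ[K] V) (I : Submodule K V) : Submodule K V := ⨆ k : ℕ, I.map (v ^ k)

theorem adjoin_eq (v : V →ₗ[K] V) (I : Submodule K V) :
    adjoin v I = I ⊔ (adjoin v I).map v := by
  rw [adjoin, Submodule.map_iSup, ← sup_iSup_nat_succ]
  congr 1
  · rw [pow_zero]; exact Submodule.map_id _
  · refine iSup_congr fun k => ?_
    rw [pow_succ', ← Submodule.map_comp]
    rfl

theorem le_adjoin (v : V →ₗ[K] V) (I : Submodule K V) : I ≤ adjoin v I := by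
  rw [adjoin_eq]; exact le_sup_left

theorem map_adjoin_le (v : V →ₗ[K] V) (I : Submodule K V) :
    (adjoin v I).map v ≤ adjoin v I := by
  conv_rhs => rw [adjoin_eq]
  exact le_sup_right

theorem adjoin_le {v : V →ₗ[K] V} {I X : Submodule K V} (h : I ≤ X) (hv : X.map v ≤ X) :
    adjoin v I ≤ X := by
  refine iSup_le fun k => ?_
  induction k with
  | zero => rw [pow_zero]; exact (Submodule.map_id I).le.trans h
  | succ k ih =>
    rw [pow_succ']
    exact (Submodule.map_comp (v ^ k) v I).le.trans ((Submodule.map_mono ih).trans hv)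

/-- The partial sums of `v I + v² I + ⋯`. -/
def partialSum (v : V →ₗ[K] V) (I : Submodule K V) : ℕ → Submodule K V
  | 0 => ⊥
  | k + 1 => (I ⊔ partialSum v I k).map v

theorem partialSum_mono (v : V →ₗ[K] V) (I : Submodule K V) : Monotone (partialSum v I) := by
  refine monotone_nat_of_le_succ fun k => ?_
  induction k with
  | zero => exact bot_le
  | succ k ih => exact Submodule.map_mono (sup_le_sup_left ih _)

theorem exists_mem_partialSum {v : V →ₗ[K] V} {I : Submodule K V} {x : V} (hx : x ∈ (adjoin v I).map v) :
    ∃ k, x ∈ partialSum v I k := by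
  have hd : Directed (· ≤ ·) (partialSum v I) := (partialSum_mono v I).directed_le
  rw [← Submodule.mem_iSup_of_directed _ hd]
  -- It follows that `I` together with all partial sums is stable under `v`, so it contains `I[v]`.
  have h1 : (I ⊔ ⨆ k, partialSum v I k).map v ≤ ⨆ k, partialSum v I k := by
    rw [sup_iSup, Submodule.map_iSup]
    exact iSup_le fun k => le_iSup (partialSum v I) (k + 1)
  exact h1 (Submodule.map_mono (adjoin_le le_sup_left (h1.trans le_sup_right)) hx)

namespace IsFrame

variable {u v : V →ₗ[K] V} {H I : Submodule K V} (h : IsFrame u v H I)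
include h

/-- Induction on the number of terms. If `x = v (a + n)` lies in `H`, then `u x = a + n` does too,
hence so does `n`, and `n = 0` by induction. Now `u x = a ∈ I` forces `x = 0`, since `I` meets `u H`
trivially. -/
theorem eq_zero_of_mem {x : V} (hx : x ∈ (adjoin v I).map v) (hH : x ∈ H) : x = 0 := by
  obtain ⟨k, hk⟩ := exists_mem_partialSum hx
  clear hx
  induction k generalizing x with
  | zero => exact hk
  | succ k ih =>
    obtain ⟨y, hy, rfl⟩ := hk
    obtain ⟨a, ha, n, hn, rfl⟩ := Submodule.mem_sup.1 hy
    have h1 : a + n ∈ H := by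
      have := h.map_mem _ hH
      rwa [h.uv] at this
    have h2 : n = 0 := ih (by simpa using H.sub_mem h1 (h.le ha)) hn
    subst h2
    refine h.eq_zero _ hH ?_
    rwa [h.uv, add_zero]

/-- Induction on the pole order `k`. Write `u x = y + z`, split `y = a + u y'` with `a ∈ I`, and
apply `v`: the polar part of `x` is `v a + v z`. -/
theorem exists_add_mem (x : V) : ∃ y ∈ H, ∃ z ∈ (adjoin v I).map v, x = y + z := by
  obtain ⟨k, hk⟩ := h.exists_pow_mem x
  induction k generalizing x with
  | zero => exact ⟨x, hk, 0, Submodule.zero_mem _, (add_zero _).symm⟩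
  | succ k ih =>
    obtain ⟨y, hy, z, hz, hyz⟩ := ih (u x) hk
    obtain ⟨a, ha, y', hy', rfl⟩ := h.exists_add y hy
    refine ⟨y', hy', v a + v z, Submodule.add_mem _ ?_ ?_, ?_⟩
    · exact Submodule.mem_map_of_mem (le_adjoin v I ha)
    · exact Submodule.mem_map_of_mem (map_adjoin_le v I hz)
    · rw [← h.vu x, hyz, map_add, map_add, h.vu]
      abel

theorem mem_of_mem_adjoin {x : V} (hx : x ∈ adjoin v I) (hH : x ∈ H) : x ∈ I := by
  rw [adjoin_eq] at hx
  obtain ⟨a, ha, n, hn, rfl⟩ := Submodule.mem_sup.1 hx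
  have : n = 0 := h.eq_zero_of_mem hn (by simpa using H.sub_mem hH (h.le ha))
  rwa [this, add_zero]

end IsFrame

end LatticeDecomposition

/-! ### The Gauss-Manin system of a germ -/

namespace Brieskorn

section Fibre

open LatticeDecomposition

theorem pd_comm {ι : Type*} (i j : ι) (f : Conv ι) : pd i (pd j f) = pd j (pd i f) := by
  classical
  refine Subtype.ext (MvPowerSeries.ext fun ν => ?_)
  change MvPowerSeries.coeff ν (MvPowerSeries.pderiv ℂ i (MvPowerSeries.pderiv ℂ j f)) =
    MvPowerSeries.coeff ν (MvPowerSeries.pderiv ℂ j (MvPowerSeries.pderiv ℂ i f))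
  simp only [MvPowerSeries.coeff_pderiv, Finsupp.add_apply]
  by_cases hij : i = j
  · rw [hij]
  · rw [Finsupp.single_eq_of_ne hij, Finsupp.single_eq_of_ne (Ne.symm hij), add_right_comm]
    push_cast
    ring

theorem exists_coeffU_eq_zero {B : Type*} [CommRing B] [Algebra ℂ B] (w : Laur B) :
    ∃ K : ℕ, ∀ k : ℤ, k < -K → coeffU k w = 0 := by
  refine ⟨(HahnSeries.order (Γ := ℤ) (R := B) w).natAbs, fun k hk => ?_⟩
  exact HahnSeries.coeff_eq_zero_of_lt_order (Γ := ℤ) (R := B) (x := w) (by omega)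

variable {n : ℕ}

theorem constU_mem_lattU (b : Ox n) : constU _ b ∈ lattU n := fun _ hk =>
  HahnSeries.coeff_single_of_ne (Γ := ℤ) (r := b) (ne_of_lt hk)

theorem coeffU_constU (b : Ox n) (k : ℤ) :
    coeffU k (constU _ b) = if k = 0 then b else 0 := by
  split_ifs with h
  · subst h; exact HahnSeries.coeff_single_same (Γ := ℤ) 0 b
  · exact HahnSeries.coeff_single_of_ne (Γ := ℤ) (r := b) h

theorem upow_zero (B : Type*) [CommRing B] : upow B 0 = 1 := rfl

theorem upow_mul_mem_lattU {j : ℤ} (hj : 0 ≤ j) {w : OxU n} (hw : w ∈ lattU n) :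
    upow _ j * w ∈ lattU n := fun k hk => by
  rw [coeffU_upow_mul]
  exact hw _ (by omega)

/-- The operator `u ∂_{x_i} - ∂f/∂x_i`. -/
noncomputable def twistU (f : Ox n) (i : Fin (n + 1)) : OxU n →ₗ[ℂ] OxU n :=
  LinearMap.mulLeft ℂ (upow _ 1) ∘ₗ (liftU (pd i) : OxU n →ₗ[ℂ] OxU n) -
    LinearMap.mulLeft ℂ (constU _ (pd i f))

theorem twistU_apply (f : Ox n) (i : Fin (n + 1)) (w : OxU n) :
    twistU f i w = upow _ 1 * liftU (pd i) w - constU _ (pd i f) * w := rfl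

theorem coeffU_twistU (f : Ox n) (i : Fin (n + 1)) (w : OxU n) (k : ℤ) :
    coeffU k (twistU f i w) = pd i (coeffU (k - 1) w) - pd i f * coeffU k w := by
  rw [twistU_apply, map_sub, coeffU_upow_mul, coeffU_liftU, coeffU_constU_mul]

theorem diffU_apply (f : Ox n) (η : Fin (n + 1) → OxU n) : diffU f η = ∑ i, twistU f i (η i) := rfl

theorem twistU_comm (f : Ox n) (i j : Fin (n + 1)) (w : OxU n) :
    twistU f i (twistU f j w) = twistU f j (twistU f i w) := by
  ext1 k
  simp only [coeffU_twistU, map_sub, Derivation.leibniz, smul_eq_mul]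
  rw [pd_comm i j f, pd_comm i j (coeffU (k - 1 - 1) w)]
  ring

/-- This is `(u d - df ∧)² = 0`, with a form of degree `n - 1` encoded as a skew matrix. The
operators `twistU f i` commute, so exchanging the two indices changes the sign of the double sum. -/
theorem diffU_skew (f : Ox n) (β : Fin (n + 1) → Fin (n + 1) → OxU n)
    (hβ : ∀ i j, β i j = -β j i) : diffU f (fun j => ∑ i, twistU f i (β i j)) = 0 := by
  have h : diffU f (fun j => ∑ i, twistU f i (β i j)) =
      -diffU f (fun j => ∑ i, twistU f i (β i j)) := by
    simp only [diffU_apply, map_sum]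
    conv_lhs => rw [Finset.sum_comm]
    rw [← Finset.sum_neg_distrib]
    refine Finset.sum_congr rfl fun i _ => ?_
    rw [← Finset.sum_neg_distrib]
    refine Finset.sum_congr rfl fun j _ => ?_
    rw [twistU_comm, hβ, map_neg, map_neg]
  have h2 : (2 : ℂ) • diffU f (fun j => ∑ i, twistU f i (β i j)) = 0 := by
    rw [two_smul]
    exact add_eq_zero_iff_eq_neg.2 h
  exact (smul_eq_zero.1 h2).resolve_left two_ne_zero

/-- Induction on the pole order of `η`. The lowest polar coefficient of `diffU f η` must vanish, so
the lowest polar coefficients of the `η i` form a relation between the `∂_{x_i} f`. It is a Koszul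
relation, and subtracting the corresponding exact form lowers the pole order. -/
theorem exists_lattU_diffU_eq {f : Ox n} (hf : IsolatedSingularity f)
    (η : Fin (n + 1) → OxU n) (h : diffU f η ∈ lattU n) :
    ∃ η' : Fin (n + 1) → OxU n, (∀ i, η' i ∈ lattU n) ∧ diffU f η' = diffU f η := by
  obtain ⟨K, hK⟩ : ∃ K : ℕ, ∀ i, ∀ k : ℤ, k < -K → coeffU k (η i) = 0 := by
    choose K hK using fun i => exists_coeffU_eq_zero (η i)
    refine ⟨∑ i, K i, fun i k hk => hK i k (lt_of_lt_of_le hk ?_)⟩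
    have := Finset.single_le_sum (f := K) (fun _ _ => Nat.zero_le _) (Finset.mem_univ i)
    omega
  induction K generalizing η with
  | zero => exact ⟨η, fun i k hk => hK i k (by simpa using hk), rfl⟩
  | succ K ih =>
    -- In degree `-(K+1)` the term `u d` contributes nothing, as it would involve the coefficients
    -- of `η` in degree `-(K+2)`.
    have h0 : ∑ i, pd i f * coeffU (-(K + 1 : ℤ)) (η i) = 0 := by
      have := h (-(K + 1 : ℤ)) (by omega)
      rw [diffU_apply, map_sum] at this
      simp only [coeffU_twistU] at this
      rw [← neg_eq_zero, ← this, ← Finset.sum_neg_distrib]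
      refine Finset.sum_congr rfl fun i _ => ?_
      rw [hK i (-(K + 1 : ℤ) - 1) (by push_cast; omega), map_zero, zero_sub]
    obtain ⟨b, hb, hbη⟩ := hf.exists_skew _ h0
    let β : Fin (n + 1) → Fin (n + 1) → OxU n := fun i j =>
      upow _ (-(K + 1 : ℤ)) * constU _ (b i j)
    have hβ : ∀ i j, β i j = -β j i := fun i j => by
      simp only [β]
      rw [hb i j, map_neg, mul_neg]
    have hc : ∀ (k : ℤ) i j, coeffU k (β i j) = if k = -(K + 1 : ℤ) then b i j else 0 := by
      intro k i j
      simp only [β]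
      rw [coeffU_upow_mul, coeffU_constU]
      exact if_congr (by omega) rfl rfl
    -- The added term has coefficient `-η_j` at `u^{-(K+1)}`, coming from `-df ∧`; its `u d` part
    -- only enters at `u^{-K}`.
    have hη : diffU f (η + fun j => ∑ i, twistU f i (β i j)) = diffU f η := by
      rw [map_add, diffU_skew f β hβ, add_zero]
    obtain ⟨η', h1, h2⟩ := ih (η + fun j => ∑ i, twistU f i (β i j)) (by rwa [hη])
      (fun j k hk => by
        rw [Pi.add_apply, map_add, map_sum]
        simp only [coeffU_twistU, hc]
        simp only [if_neg (show ¬ k - 1 = -(K + 1 : ℤ) by omega)]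
        by_cases hk' : k = -(K + 1 : ℤ)
        · subst hk'
          simp only [if_true, map_zero, zero_sub]
          rw [Finset.sum_neg_distrib, hbη, add_neg_cancel]
        · simp only [if_neg hk']
          rw [hK j k (by push_cast; omega)]
          simp)
    exact ⟨η', h1, h2.trans hη⟩

theorem mk_mem_range_jf {f : Ox n} {z : Gf f} :
    z ∈ LinearMap.range (jf f) ↔
      ∃ w ∈ lattU n, (Submodule.Quotient.mk w : Gf f) = z := by
  constructor
  · rintro ⟨x, rfl⟩
    obtain ⟨w, rfl⟩ := Submodule.Quotient.mk_surjective _ x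
    exact ⟨w.1, w.2, rfl⟩
  · rintro ⟨w, hw, rfl⟩
    exact ⟨Submodule.Quotient.mk ⟨w, hw⟩, rfl⟩

theorem jf_injective {f : Ox n} (hf : IsolatedSingularity f) : Function.Injective (jf f) := by
  rw [injective_iff_map_eq_zero]
  intro x hx
  obtain ⟨w, rfl⟩ := Submodule.Quotient.mk_surjective _ x
  obtain ⟨η, hη⟩ := (Submodule.Quotient.mk_eq_zero _).1 hx
  change diffU f η = w.1 at hη
  obtain ⟨η', h1, h2⟩ := exists_lattU_diffU_eq hf η (hη ▸ w.2)
  exact (Submodule.Quotient.mk_eq_zero _).2 ⟨η', fun i _ => h1 i, h2.trans hη⟩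

/-- Multiplication by `u` on `Ĝ_f`. -/
noncomputable def uf (f : Ox n) : Gf f →ₗ[ℂ] Gf f :=
  Submodule.mapQ _ _ (LinearMap.mulLeft ℂ (upow (Ox n) 1)) (by
    rintro _ ⟨η, rfl⟩
    refine ⟨fun i => upow _ 1 * η i, ?_⟩
    rw [LinearMap.mulLeft_apply, diffU_apply, diffU_apply, Finset.mul_sum]
    refine Finset.sum_congr rfl fun i _ => ?_
    rw [twistU_apply, twistU_apply, Derivation.leibniz, liftU_upow, smul_zero, add_zero,
      smul_eq_mul]
    ring)

theorem uf_mk (f : Ox n) (w : OxU n) :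
    uf f (Submodule.Quotient.mk w) = Submodule.Quotient.mk (upow _ 1 * w) := rfl

theorem uinvf_mk (f : Ox n) (w : OxU n) :
    uinvf f (Submodule.Quotient.mk w) = Submodule.Quotient.mk (upow _ (-1) * w) := rfl

theorem uinvf_uf (f : Ox n) (z : Gf f) : uinvf f (uf f z) = z := by
  obtain ⟨w, rfl⟩ := Submodule.Quotient.mk_surjective _ z
  rw [uf_mk, uinvf_mk, ← mul_assoc, upow_mul_upow]
  exact congrArg _ (one_mul w)

theorem uf_uinvf (f : Ox n) (z : Gf f) : uf f (uinvf f z) = z := by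
  obtain ⟨w, rfl⟩ := Submodule.Quotient.mk_surjective _ z
  rw [uinvf_mk, uf_mk, ← mul_assoc, upow_mul_upow]
  exact congrArg _ (one_mul w)

theorem uf_pow_mk (f : Ox n) (w : OxU n) (k : ℕ) :
    (uf f ^ k) (Submodule.Quotient.mk w) = Submodule.Quotient.mk (upow _ (k : ℤ) * w) := by
  induction k with
  | zero => rw [pow_zero, Nat.cast_zero, upow_zero, one_mul]; rfl
  | succ k ih =>
    rw [pow_succ', Module.End.mul_apply, ih, uf_mk, ← mul_assoc, upow_mul_upow]
    push_cast
    rw [add_comm (1 : ℤ)]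

theorem uf_mem_range_jf {f : Ox n} {z : Gf f} (hz : z ∈ LinearMap.range (jf f)) :
    uf f z ∈ LinearMap.range (jf f) := by
  obtain ⟨w, hw, rfl⟩ := mk_mem_range_jf.1 hz
  exact mk_mem_range_jf.2 ⟨_, upow_mul_mem_lattU zero_le_one hw, rfl⟩

theorem exists_uf_pow_mem {f : Ox n} (z : Gf f) : ∃ k : ℕ, (uf f ^ k) z ∈ LinearMap.range (jf f) := by
  obtain ⟨w, rfl⟩ := Submodule.Quotient.mk_surjective _ z
  obtain ⟨K, hK⟩ := exists_coeffU_eq_zero w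
  refine ⟨K, mk_mem_range_jf.2 ⟨_, fun k hk => ?_, (uf_pow_mk f w K).symm⟩⟩
  rw [coeffU_upow_mul]
  exact hK _ (by omega)

/-- The kernel of `Ĥ''_f → Ω_f` is `u Ĥ''_f`. -/
theorem exists_jf_eq_uf {f : Ox n} (x : Hf f) (hx : prf f x = 0) :
    ∃ y, jf f x = uf f (jf f y) := by
  obtain ⟨w, rfl⟩ := Submodule.Quotient.mk_surjective _ x
  obtain ⟨g, hg⟩ := (Submodule.Quotient.mk_eq_zero _).1 hx
  -- The `u⁰` coefficient of `w` is `df ∧ g`. Adding the exact form `(u d - df ∧) g` cancels it, and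
  -- the sum is divisible by `u` within the lattice.
  let η : Fin (n + 1) → OxU n := fun i => constU _ (g i)
  have hη : ∀ i, η i ∈ lattU n := fun i => constU_mem_lattU _
  have h0 : coeffU 0 (w.1 + diffU f η) = 0 := by
    rw [map_add, coeffU_diffU f η hη]
    have : (fun i => coeffU 0 (η i)) = g := funext fun i => (coeffU_constU _ 0).trans (if_pos rfl)
    rw [this, hg]
    exact add_neg_cancel _
  have hd : diffU f η ∈ lattU n := by
    rw [diffU_apply]
    refine Submodule.sum_mem _ fun i _ k hk => ?_
    rw [coeffU_twistU, hη i _ (by omega), hη i _ hk]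
    simp
  have hl : upow _ (-1) * (w.1 + diffU f η) ∈ lattU n := fun k hk => by
    rw [coeffU_upow_mul]
    rcases eq_or_ne k (-1) with rfl | hne
    · exact h0
    · exact (lattU n).add_mem w.2 hd _ (by omega)
  refine ⟨Submodule.Quotient.mk ⟨_, hl⟩, ?_⟩
  change (Submodule.Quotient.mk w.1 : Gf f) =
    uf f (uinvf f (Submodule.Quotient.mk (w.1 + diffU f η)))
  rw [uf_uinvf]
  refine ((Submodule.Quotient.eq _).2 ⟨-η, ?_⟩)
  rw [map_neg]
  abel

/-- Injectivity of `jf` moves the equation from the Gauss-Manin system into the lattice, where `u =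
0` can be substituted. -/
theorem prf_eq_zero {f : Ox n} (hf : IsolatedSingularity f) {x y : Hf f}
    (h : jf f x = uf f (jf f y)) : prf f x = 0 := by
  obtain ⟨w, rfl⟩ := Submodule.Quotient.mk_surjective _ y
  have : x = Submodule.Quotient.mk ⟨upow _ 1 * w.1, upow_mul_mem_lattU zero_le_one w.2⟩ :=
    jf_injective hf h
  rw [this]
  have h0 : coeffU 0 (upow _ 1 * w.1) = 0 := by
    rw [coeffU_upow_mul]
    exact w.2 _ (by norm_num)
  change (Submodule.Quotient.mk (coeffU 0 (upow _ 1 * w.1)) : Omegaf f) = 0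
  rw [h0]
  rfl

/-- The image of a section of `Ĥ''_f → Ω_f` is a complement of `u Ĥ''_f` in `Ĥ''_f`. -/
theorem isFrame_of_section {f : Ox n} (hf : IsolatedSingularity f) (σ₀ : Omegaf f →ₗ[ℂ] Hf f)
    (hσ : prf f ∘ₗ σ₀ = LinearMap.id) :
    IsFrame (uf f) (uinvf f) (LinearMap.range (jf f)) ((LinearMap.range σ₀).map (jf f)) where
  vu := uinvf_uf f
  uv := uf_uinvf f
  le := by
    rintro _ ⟨x, -, rfl⟩
    exact ⟨x, rfl⟩
  map_mem _ := uf_mem_range_jf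
  exists_add := by
    rintro _ ⟨x, rfl⟩
    have hx : prf f (x - σ₀ (prf f x)) = 0 := by
      rw [map_sub, sub_eq_zero]
      exact (LinearMap.congr_fun hσ (prf f x)).symm
    obtain ⟨y, hy⟩ := exists_jf_eq_uf _ hx
    refine ⟨_, ⟨σ₀ (prf f x), ⟨_, rfl⟩, rfl⟩, _, ⟨y, rfl⟩, ?_⟩
    rw [← hy, map_sub]
    abel
  eq_zero := by
    rintro _ ⟨y, rfl⟩ ⟨_, ⟨x, rfl⟩, hx⟩
    have h1 := prf_eq_zero hf hx
    have h2 : x = 0 := by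
      rw [← h1]
      exact (LinearMap.congr_fun hσ x).symm
    rw [← uinvf_uf f (jf f y), ← hx, h2, map_zero, map_zero, map_zero]
  exists_pow_mem := exists_uf_pow_mem

end Fibre

end Brieskorn

/-! ### Power series with prescribed properties, and exponentials -/

namespace Brieskorn

/-- Recursive construction of a family, each member being chosen subject to a condition on the
previous ones. -/
theorem exists_family_of_step {I B : Type*} [PartialOrder I] [WellFoundedLT I] [AddCommGroup B]
    (P : I → (I → B) → Prop)
    (hloc : ∀ α h h', (∀ γ ≤ α, h γ = h' γ) → P α h → P α h')
    (hstep : ∀ α h, (∀ γ < α, P γ h) → ∀ [DecidableEq I], ∃ b, P α (h + Pi.single α b)) :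
    ∃ h : I → B, ∀ α, P α h := by
  classical
  let ext (α : I) (r : ∀ γ, γ < α → B) : I → B := fun γ => if hγ : γ < α then r γ hγ else 0
  let F (α : I) (r : ∀ γ, γ < α → B) : B :=
    -- The value 0 is only a default: `hex` below shows that the first case always occurs along the
    -- recursion.
    if h : ∃ b, P α (ext α r + Pi.single α b) then h.choose else 0
  let h : I → B := (wellFounded_lt (α := I)).fix F
  have hh : ∀ α, h α = F α (fun γ _ => h γ) := fun α => WellFounded.fix_eq _ _ _
  refine ⟨h, fun α => ?_⟩
  induction α using (wellFounded_lt (α := I)).induction with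
  | _ α ih =>
  have hagree : ∀ γ < α, ext α (fun γ _ => h γ) γ = h γ := fun γ hγ => dif_pos hγ
  have hex : ∃ b, P α (ext α (fun γ _ => h γ) + Pi.single α b) := by
    refine hstep α _ fun γ hγ => hloc γ h _ (fun δ hδ => ?_) (ih γ hγ)
    exact (hagree δ (lt_of_le_of_lt hδ hγ)).symm
  have hFα : h α = hex.choose := (hh α).trans (dif_pos hex)
  refine hloc α _ _ (fun γ hγ => ?_) hex.choose_spec
  rcases eq_or_lt_of_le hγ with rfl | hlt
  · rw [Pi.add_apply, Pi.single_eq_same, ← hFα]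
    exact (congrArg (· + h γ) (dif_neg (lt_irrefl γ))).trans (zero_add _)
  · rw [Pi.add_apply, Pi.single_eq_of_ne hlt.ne, add_zero]
    exact hagree γ hlt

/-! ### Leading coefficients and exponential series -/

section Exp

open MvPowerSeries

variable {τ B : Type*} [CommRing B]

/-- At a leading exponent, multiplication only sees the value of `a` at `s = 0`. This is how
operators over the parameter space are compared with those of the germ `f`. -/
theorem coeff_mul_of_lt (a w : MvPowerSeries τ B) (α : τ →₀ ℕ) (h : ∀ γ < α, coeff γ w = 0) :
    coeff α (a * w) = constantCoeff a * coeff α w := by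
  classical
  rw [coeff_mul, Finset.sum_eq_single (0, α)]
  · rfl
  · intro p hp hne
    have hp' := Finset.HasAntidiagonal.mem_antidiagonal.1 hp
    rw [h p.2, mul_zero]
    refine lt_of_le_of_ne (hp' ▸ le_add_self) fun h2 => hne ?_
    have : p.1 = 0 := by rwa [h2, add_eq_right] at hp'
    exact Prod.ext this h2
  · intro h
    exact absurd (Finset.HasAntidiagonal.mem_antidiagonal.2 (zero_add α)) h

variable [Algebra ℂ B]

theorem constantCoeff_expS (g : MvPowerSeries τ B) : constantCoeff (expS g) = 1 := by
  change ∑ k ∈ Finset.range ((0 : τ →₀ ℕ).degree + 1), _ = _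
  rw [map_zero, zero_add, Finset.sum_range_one]
  simp

theorem pderiv_expS (i : τ) {g : MvPowerSeries τ B} (hg : constantCoeff g = 0) :
    pderiv B i (expS g) = pderiv B i g * expS g := by
  classical
  have hT : ∀ N : ℕ, pderiv B i (∑ k ∈ Finset.range (N + 1), ((k.factorial : ℂ)⁻¹) • g ^ k) =
      pderiv B i g * ∑ k ∈ Finset.range N, ((k.factorial : ℂ)⁻¹) • g ^ k := by
    intro N
    have hs : ∀ (c : ℂ) (w : MvPowerSeries τ B), pderiv B i (c • w) = c • pderiv B i w :=
      fun c w => by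
        ext α
        rw [coeff_pderiv]
        exact (smul_mul_assoc c (coeff (α + Finsupp.single i 1) w) _).trans
          (congrArg (c • ·) (coeff_pderiv w α).symm)
    rw [Finset.sum_range_succ', map_add, map_sum, Finset.mul_sum, hs, pow_zero,
      Derivation.map_one_eq_zero, smul_zero, add_zero]
    refine Finset.sum_congr rfl fun k _ => ?_
    rw [hs, Derivation.leibniz_pow, Nat.add_sub_cancel, ← Nat.cast_smul_eq_nsmul ℂ, smul_smul,
      Nat.factorial_succ, smul_eq_mul, mul_comm (pderiv B i g), smul_mul_assoc]
    congr 1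
    have : ((k : ℂ) + 1) ≠ 0 := Nat.cast_add_one_ne_zero k
    have h2 : (k.factorial : ℂ) ≠ 0 := Nat.cast_ne_zero.2 k.factorial_ne_zero
    push_cast
    field_simp
  ext α
  -- The coefficient of `s^α` in the derivative comes from degree `|α| + 1`, so the truncated
  -- exponential needs `|α| + 2` terms; its derivative is the truncation with `|α| + 1` terms.
  rw [coeff_pderiv, coeff_expS_eq hg _ (α.degree + 1 + 1) (by simp), ← coeff_pderiv, hT,
    coeff_mul, coeff_mul]
  refine Finset.sum_congr rfl fun p hp => ?_
  rw [coeff_expS_eq hg p.2 (α.degree + 1)]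
  rw [← Finset.HasAntidiagonal.mem_antidiagonal.1 hp, map_add]
  omega

/-- All partial derivatives of the product vanish and its constant term is 1; in the absence of
torsion these data determine a series. -/
theorem expS_mul_expS_neg {g : MvPowerSeries τ B} (hg : constantCoeff g = 0) :
    expS g * expS (-g) = 1 := by
  have : IsAddTorsionFree B := .of_isTorsionFree ℂ B
  have hg' : constantCoeff (-g) = 0 := by rw [map_neg, hg, neg_zero]
  refine pderiv.ext (fun i => ?_) ?_
  · rw [Derivation.leibniz, pderiv_expS i hg, pderiv_expS i hg', Derivation.map_one_eq_zero,
      map_neg, smul_eq_mul, smul_eq_mul]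
    ring
  · rw [map_mul, constantCoeff_expS, constantCoeff_expS, mul_one, map_one]

end Exp

/-! ### Exponential operators and coefficients with respect to `s` -/

section Family

variable {n m : ℕ}

theorem constantCoeff_exponent {F F' : OxS n m}
    (h : MvPowerSeries.constantCoeff F = MvPowerSeries.constantCoeff F') :
    MvPowerSeries.constantCoeff (upowS n m (-1) * emb (F' - F)) = 0 := by
  rw [map_mul, emb, MvPowerSeries.constantCoeff_map, map_sub, h, sub_self, map_zero, mul_zero]

theorem expOp_mk {F F' : OxS n m}
    (h : MvPowerSeries.constantCoeff F = MvPowerSeries.constantCoeff F') (w : OxUS n m) :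
    expOp F F' h (Submodule.Quotient.mk w) =
      Submodule.Quotient.mk (expS (upowS n m (-1) * emb (F' - F)) * w) := rfl

theorem expOp_expOp {F F' : OxS n m}
    (h : MvPowerSeries.constantCoeff F = MvPowerSeries.constantCoeff F') (z : GS F) :
    expOp F' F h.symm (expOp F F' h z) = z := by
  obtain ⟨w, rfl⟩ := Submodule.Quotient.mk_surjective _ z
  rw [expOp_mk, expOp_mk, ← mul_assoc, mul_comm (expS _) (expS _),
    show upowS n m (-1) * emb (F - F') = -(upowS n m (-1) * emb (F' - F)) by
      rw [← mul_neg, ← map_neg, neg_sub],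
    expS_mul_expS_neg (constantCoeff_exponent h), one_mul]

/-- Multiplication by `u` on `Ĝ_{F,Ŝ}`. -/
noncomputable def uS (F : OxS n m) : GS F →ₗ[CS m] GS F :=
  Submodule.mapQ _ _ (LinearMap.mulLeft (CS m) (upowS n m 1)) (by
    rintro _ ⟨η, rfl⟩
    refine ⟨fun i => upowS n m 1 * η i, ?_⟩
    rw [diffS_apply, diffS_apply, LinearMap.mulLeft_apply, Finset.mul_sum]
    refine Finset.sum_congr rfl fun i _ => ?_
    rw [Derivation.leibniz, liftS_upowS, smul_zero, add_zero, smul_eq_mul]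
    ring)

theorem uS_mk (F : OxS n m) (w : OxUS n m) :
    uS F (Submodule.Quotient.mk w) = Submodule.Quotient.mk (upowS n m 1 * w) := rfl

theorem uinvS_mk (F : OxS n m) (w : OxUS n m) :
    uinvS F (Submodule.Quotient.mk w) = Submodule.Quotient.mk (upowS n m (-1) * w) := rfl

theorem uinvS_uS (F : OxS n m) (z : GS F) : uinvS F (uS F z) = z := by
  obtain ⟨w, rfl⟩ := Submodule.Quotient.mk_surjective _ z
  rw [uS_mk, uinvS_mk, ← mul_assoc, mul_comm (upowS n m (-1)), upowS_one_mul_neg_one, one_mul]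

theorem uS_uinvS (F : OxS n m) (z : GS F) : uS F (uinvS F z) = z := by
  obtain ⟨w, rfl⟩ := Submodule.Quotient.mk_surjective _ z
  rw [uinvS_mk, uS_mk, ← mul_assoc, upowS_one_mul_neg_one, one_mul]

theorem expOp_uS {F F' : OxS n m}
    (h : MvPowerSeries.constantCoeff F = MvPowerSeries.constantCoeff F') (z : GS F) :
    expOp F F' h (uS F z) = uS F' (expOp F F' h z) := by
  obtain ⟨w, rfl⟩ := Submodule.Quotient.mk_surjective _ z
  rw [uS_mk, expOp_mk, expOp_mk, uS_mk, mul_left_comm]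

theorem expOp_uinvS {F F' : OxS n m}
    (h : MvPowerSeries.constantCoeff F = MvPowerSeries.constantCoeff F') (z : GS F) :
    expOp F F' h (uinvS F z) = uinvS F' (expOp F F' h z) := by
  obtain ⟨w, rfl⟩ := Submodule.Quotient.mk_surjective _ z
  rw [uinvS_mk, expOp_mk, expOp_mk, uinvS_mk, mul_left_comm]

theorem dsS_mk (F : OxS n m) (i : Fin m) (w : OxUS n m) :
    dsS F i (Submodule.Quotient.mk w) = Submodule.Quotient.mk
      (MvPowerSeries.pderiv (OxU n) i w -
        upowS n m (-1) * emb (MvPowerSeries.pderiv (Ox n) i F) * w) := rfl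

theorem pderiv_upowS (i : Fin m) (k : ℤ) :
    MvPowerSeries.pderiv (OxU n) i (upowS n m k) = 0 := MvPowerSeries.pderiv_C

/-- Differentiating the exponential produces `u⁻¹ ∂_{s_i}(F' - F)`, which is exactly the difference
of the two twisting terms. -/
theorem expOp_dsS {F F' : OxS n m}
    (h : MvPowerSeries.constantCoeff F = MvPowerSeries.constantCoeff F') (i : Fin m) (z : GS F) :
    expOp F F' h (dsS F i z) = dsS F' i (expOp F F' h z) := by
  obtain ⟨w, rfl⟩ := Submodule.Quotient.mk_surjective _ z
  rw [dsS_mk, expOp_mk, expOp_mk, dsS_mk, Derivation.leibniz,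
    pderiv_expS i (constantCoeff_exponent h), Derivation.leibniz, pderiv_upowS, pderiv_emb,
    map_sub, map_sub, map_sub]
  simp only [smul_eq_mul]
  congr 1
  ring

theorem dsS_uinvS (F : OxS n m) (i : Fin m) (z : GS F) :
    dsS F i (uinvS F z) = uinvS F (dsS F i z) := by
  obtain ⟨w, rfl⟩ := Submodule.Quotient.mk_surjective _ z
  rw [uinvS_mk, dsS_mk, dsS_mk, uinvS_mk, Derivation.leibniz, pderiv_upowS]
  simp only [smul_eq_mul]
  congr 1
  ring

/-! ### Coefficients with respect to `s` -/

theorem coeff_diffS_of_lt {F : OxS n m} {f : Ox n} (h : MvPowerSeries.constantCoeff F = f)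
    (η : Fin (n + 1) → OxUS n m) (α : Fin m →₀ ℕ)
    (hη : ∀ γ < α, ∀ i, MvPowerSeries.coeff γ (η i) = 0) :
    MvPowerSeries.coeff α (diffS F η) = diffU f (fun i => MvPowerSeries.coeff α (η i)) := by
  rw [diffS_apply, map_sum]
  refine Finset.sum_congr rfl fun i _ => ?_
  rw [map_sub, coeff_mul_of_lt (emb _) _ α (fun γ hγ => hη γ hγ i), upowS,
    MvPowerSeries.coeff_C_mul, coeff_liftS, emb, MvPowerSeries.constantCoeff_map, ← h]
  rfl

theorem coeff_diffS_C (f : Ox n) (η : Fin (n + 1) → OxUS n m) (α : Fin m →₀ ℕ) :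
    MvPowerSeries.coeff α (diffS (MvPowerSeries.C f) η) =
      diffU f (fun i => MvPowerSeries.coeff α (η i)) := by
  rw [diffS_apply, map_sum]
  refine Finset.sum_congr rfl fun i _ => ?_
  have h : liftS (pd i) (MvPowerSeries.C f : OxS n m) = MvPowerSeries.C (pd i f) := by
    classical
    ext1 γ
    rw [coeff_liftS, MvPowerSeries.coeff_C, MvPowerSeries.coeff_C]
    split_ifs
    · rfl
    · rw [map_zero]
  rw [h, emb, MvPowerSeries.map_C, map_sub, MvPowerSeries.coeff_C_mul, upowS,
    MvPowerSeries.coeff_C_mul]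
  rfl

/-- The coefficient of `s^α` of an element of `Ĝ_{f,Ŝ} = Ĝ_f[[s]]`. -/
noncomputable def coeffG (f : Ox n) (α : Fin m →₀ ℕ) : GS (MvPowerSeries.C f : OxS n m) →+ Gf f :=
  QuotientAddGroup.map (LinearMap.range (diffS (MvPowerSeries.C f : OxS n m))).toAddSubgroup
    (LinearMap.range (diffU f)).toAddSubgroup
    (MvPowerSeries.coeff (R := OxU n) α).toAddMonoidHom (by
      rintro _ ⟨η, rfl⟩
      exact ⟨_, (coeff_diffS_C f η α).symm⟩)

theorem coeffG_mk (f : Ox n) (α : Fin m →₀ ℕ) (w : OxUS n m) :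
    coeffG f α (Submodule.Quotient.mk w) = Submodule.Quotient.mk (MvPowerSeries.coeff α w) := rfl

/-- For a constant deformation the differential acts coefficientwise in `s`, so primitives of the
coefficients can be chosen independently and assembled. Their pole orders in `u` need not be
bounded, since the coefficients of `s^α` range over all of `ℂ{x}((u))`. -/
theorem coeffG_ext {f : Ox n} {y z : GS (MvPowerSeries.C f : OxS n m)}
    (h : ∀ α, coeffG f α y = coeffG f α z) : y = z := by
  rw [← sub_eq_zero]
  replace h : ∀ α, coeffG f α (y - z) = 0 := fun α => by rw [map_sub, h, sub_self]
  generalize y - z = x at h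
  obtain ⟨w, rfl⟩ := Submodule.Quotient.mk_surjective _ x
  choose η hη using fun α => (Submodule.Quotient.mk_eq_zero _).1 (h α)
  refine (Submodule.Quotient.mk_eq_zero _).2 ⟨fun i α => η α i, MvPowerSeries.ext fun α => ?_⟩
  exact (coeff_diffS_C f (fun i α => η α i) α).trans (hη α)

theorem mem_seriesG {f : Ox n} {N : Submodule ℂ (Gf f)} {z : GS (MvPowerSeries.C f : OxS n m)} :
    z ∈ seriesG m N ↔ ∀ α, coeffG f α z ∈ N := by
  constructor
  · rintro ⟨w, hw, rfl⟩ α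
    exact hw α
  · obtain ⟨w, rfl⟩ := Submodule.Quotient.mk_surjective _ z
    exact fun h => ⟨w, h, rfl⟩

theorem coeffG_uS (f : Ox n) (α : Fin m →₀ ℕ) (z : GS (MvPowerSeries.C f : OxS n m)) :
    coeffG f α (uS _ z) = uf f (coeffG f α z) := by
  obtain ⟨w, rfl⟩ := Submodule.Quotient.mk_surjective _ z
  rw [uS_mk, coeffG_mk, coeffG_mk, uf_mk, upowS, MvPowerSeries.coeff_C_mul]

theorem coeffG_uinvS (f : Ox n) (α : Fin m →₀ ℕ) (z : GS (MvPowerSeries.C f : OxS n m)) :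
    coeffG f α (uinvS _ z) = uinvf f (coeffG f α z) := by
  obtain ⟨w, rfl⟩ := Submodule.Quotient.mk_surjective _ z
  rw [uinvS_mk, coeffG_mk, coeffG_mk, uinvf_mk, upowS, MvPowerSeries.coeff_C_mul]

theorem coeffG_dsS (f : Ox n) (α : Fin m →₀ ℕ) (i : Fin m)
    (z : GS (MvPowerSeries.C f : OxS n m)) :
    coeffG f α (dsS _ i z) = ((α i : ℂ) + 1) • coeffG f (α + Finsupp.single i 1) z := by
  obtain ⟨w, rfl⟩ := Submodule.Quotient.mk_surjective _ z
  rw [dsS_mk, MvPowerSeries.pderiv_C, map_zero, mul_zero, zero_mul, sub_zero, coeffG_mk,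
    coeffG_mk, MvPowerSeries.coeff_pderiv, ← Submodule.Quotient.mk_smul, Algebra.smul_def,
    map_add, map_natCast, map_one, mul_comm]

end Family

end Brieskorn

/-! ### The Brieskorn lattice of a deformation -/

namespace Brieskorn

section Deformation

variable {n m : ℕ}

/-- The series with given coefficients. -/
def ofCoeff (h : (Fin m →₀ ℕ) → OxU n) : OxUS n m := h

theorem coeff_ofCoeff (h : (Fin m →₀ ℕ) → OxU n) (α : Fin m →₀ ℕ) :
    MvPowerSeries.coeff α (ofCoeff h) = h α := rfl

theorem upowS_mul_mem_lattS {j : ℤ} (hj : 0 ≤ j) {w : OxUS n m} (hw : w ∈ lattS n m) :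
    upowS n m j * w ∈ lattS n m := fun α => by
  rw [upowS, MvPowerSeries.coeff_C_mul]
  exact upow_mul_mem_lattU hj (hw α)

theorem emb_mul_mem_lattS (a : OxS n m) {w : OxUS n m} (hw : w ∈ lattS n m) :
    emb a * w ∈ lattS n m := fun α => by
  classical
  rw [MvPowerSeries.coeff_mul]
  refine Submodule.sum_mem _ fun p _ k hk => ?_
  rw [emb, MvPowerSeries.coeff_map, coeffU_constU_mul, hw _ k hk, mul_zero]

theorem diffS_mem_lattS (F : OxS n m) {η : Fin (n + 1) → OxUS n m} (hη : ∀ i, η i ∈ lattS n m) :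
    diffS F η ∈ lattS n m := by
  rw [diffS_apply]
  refine Submodule.sum_mem _ fun i _ => Submodule.sub_mem _
    (upowS_mul_mem_lattS zero_le_one fun α k hk => ?_) (emb_mul_mem_lattS _ (hη i))
  rw [coeff_liftS, coeffU_liftU, hη i α k hk, map_zero]

theorem mk_mem_range_jS {F : OxS n m} {z : GS F} :
    z ∈ LinearMap.range (jS F) ↔
      ∃ w ∈ lattS n m, (Submodule.Quotient.mk w : GS F) = z := by
  constructor
  · rintro ⟨x, rfl⟩
    obtain ⟨w, rfl⟩ := Submodule.Quotient.mk_surjective _ x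
    exact ⟨w.1, w.2, rfl⟩
  · rintro ⟨w, hw, rfl⟩
    exact ⟨Submodule.Quotient.mk ⟨w, hw⟩, rfl⟩

theorem uS_mem_range_jS {F : OxS n m} {z : GS F} (hz : z ∈ LinearMap.range (jS F)) :
    uS F z ∈ LinearMap.range (jS F) := by
  obtain ⟨w, hw, rfl⟩ := mk_mem_range_jS.1 hz
  exact mk_mem_range_jS.2 ⟨_, upowS_mul_mem_lattS zero_le_one hw, rfl⟩

/-- `u ∂_{s_i}` acts on the Brieskorn lattice. -/
theorem uS_dsS_mem_range_jS {F : OxS n m} (i : Fin m) {z : GS F}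
    (hz : z ∈ LinearMap.range (jS F)) : uS F (dsS F i z) ∈ LinearMap.range (jS F) := by
  obtain ⟨w, hw, rfl⟩ := mk_mem_range_jS.1 hz
  refine mk_mem_range_jS.2 ⟨upowS n m 1 * MvPowerSeries.pderiv (OxU n) i w -
    emb (MvPowerSeries.pderiv (Ox n) i F) * w, ?_, ?_⟩
  · refine Submodule.sub_mem _ (upowS_mul_mem_lattS zero_le_one fun α => ?_)
      (emb_mul_mem_lattS _ hw)
    rw [MvPowerSeries.coeff_pderiv, mul_comm]
    have : ((α i : OxU n) + 1) = algebraMap ℂ (OxU n) (α i + 1) := by simp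
    rw [this, ← Algebra.smul_def]
    exact Submodule.smul_mem _ _ (hw _)
  · rw [dsS_mk, uS_mk]
    congr 1
    linear_combination (emb (MvPowerSeries.pderiv (Ox n) i F) * w) *
      (upowS_one_mul_neg_one (n := n) (m := m))

variable {F : OxS n m} {f : Ox n} (h : MvPowerSeries.constantCoeff F = f)

theorem Psi_Phi (z : GS F) : Psi h (Phi h z) = z := expOp_expOp _ z

theorem Phi_Psi (z : GS (MvPowerSeries.C f : OxS n m)) : Phi h (Psi h z) = z := expOp_expOp _ z

theorem Phi_uS (z : GS F) : Phi h (uS F z) = uS _ (Phi h z) := expOp_uS _ z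

theorem Phi_uinvS (z : GS F) : Phi h (uinvS F z) = uinvS _ (Phi h z) := expOp_uinvS _ z

theorem Phi_dsS (i : Fin m) (z : GS F) : Phi h (dsS F i z) = dsS _ i (Phi h z) := expOp_dsS _ i z

theorem coeff_Phi_factor (α : Fin m →₀ ℕ) (w : OxUS n m)
    (hw : ∀ γ < α, MvPowerSeries.coeff γ w = 0) :
    MvPowerSeries.coeff α
      (expS (upowS n m (-1) * emb ((MvPowerSeries.C f : OxS n m) - F)) * w) =
      MvPowerSeries.coeff α w := by
  rw [coeff_mul_of_lt _ _ _ hw, constantCoeff_expS, one_mul]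

/-- The exponential factor is 1 at `s = 0`, so `Phi` leaves leading coefficients unchanged. -/
theorem coeffG_Phi_mk (α : Fin m →₀ ℕ) (w : OxUS n m)
    (hw : ∀ γ < α, MvPowerSeries.coeff γ w = 0) :
    coeffG f α (Phi h (Submodule.Quotient.mk w)) =
      Submodule.Quotient.mk (MvPowerSeries.coeff α w) :=
  congrArg Submodule.Quotient.mk (coeff_Phi_factor α w hw)

/-- The class of `w` in the Brieskorn lattice has a representative whose coefficients vanish in all
degrees up to which the coefficients of its class in `Ĝ_f[[s]]` vanish. -/
theorem exists_diffS_coeff_eq (hf : IsolatedSingularity f) {w : OxUS n m} (hw : w ∈ lattS n m) :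
    ∃ η : Fin (n + 1) → OxUS n m, (∀ i, η i ∈ lattS n m) ∧ ∀ α : Fin m →₀ ℕ,
      (∀ γ ≤ α, coeffG f γ (Phi h (Submodule.Quotient.mk w)) = 0) →
      MvPowerSeries.coeff α (w - diffS F η) = 0 := by
  let S (g : (Fin m →₀ ℕ) → (Fin (n + 1) → lattU n)) : Fin (n + 1) → OxUS n m :=
    fun i => ofCoeff fun α => (g α i : OxU n)
  have hS : ∀ g i, S g i ∈ lattS n m := fun g i α => (g α i).2
  have hSadd : ∀ g g', S (g + g') = S g + S g' := fun g g' => rfl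
  obtain ⟨g, hg⟩ := exists_family_of_step
    (fun α g => (∀ γ ≤ α, coeffG f γ (Phi h (Submodule.Quotient.mk w)) = 0) →
      MvPowerSeries.coeff α (w - diffS F (S g)) = 0) (fun α g g' hgg hα h0 => by
        -- Two families that agree up to `α` differ by one starting beyond `α`, which does not
        -- affect the coefficient of `s^α`.
        have h1 : diffS F (S g') = diffS F (S g) + diffS F (S (g' - g)) := by
          rw [← map_add, ← hSadd, add_sub_cancel]
        have hz : ∀ γ ≤ α, ∀ i, MvPowerSeries.coeff γ (S (g' - g) i) = 0 := fun γ hγ i => by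
          simp only [S, coeff_ofCoeff, Pi.sub_apply]
          rw [hgg γ hγ, sub_self]
          rfl
        rw [h1, ← sub_sub, map_sub, hα h0, coeff_diffS_of_lt h _ _ fun γ hγ => hz γ hγ.le]
        have : (fun i => MvPowerSeries.coeff α (S (g' - g) i)) = 0 := funext fun i => hz α le_rfl i
        rw [this, map_zero, sub_zero]) (fun α g hg => by
      intro _
      by_cases h0 : ∀ γ ≤ α, coeffG f γ (Phi h (Submodule.Quotient.mk w)) = 0
      swap
      · exact ⟨0, fun h1 => absurd h1 h0⟩
      have hlow : ∀ γ < α, MvPowerSeries.coeff γ (w - diffS F (S g)) = 0 := fun γ hγ =>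
        hg γ hγ fun δ hδ => h0 δ (hδ.trans hγ.le)
      have hcl : (Submodule.Quotient.mk (w - diffS F (S g)) : GS F) = Submodule.Quotient.mk w :=
        (Submodule.Quotient.eq _).2 ⟨-S g, by rw [map_neg]; abel⟩
      have h1 := h0 α le_rfl
      -- After the corrections in lower degrees, the coefficient of `s^α` is a leading one. Its
      -- class in `Ĝ_f` vanishes, so it is exact, and having no pole it has a primitive without
      -- pole. This primitive is the correction in degree `α`.
      rw [← hcl, coeffG_Phi_mk h α _ hlow] at h1
      obtain ⟨η, hη⟩ := (Submodule.Quotient.mk_eq_zero _).1 h1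
      have hl : diffU f η ∈ lattU n := by
        rw [hη]
        exact Submodule.sub_mem _ hw (diffS_mem_lattS F (hS g)) α
      obtain ⟨η', hη', hd⟩ := exists_lattU_diffU_eq hf η hl
      refine ⟨fun i => ⟨η' i, hη' i⟩, fun _ => ?_⟩
      rw [hSadd, map_add, ← sub_sub, map_sub, ← hη, coeff_diffS_of_lt h]
      · rw [← hd, sub_eq_zero]
        congr 1
        funext i
        simp only [S, coeff_ofCoeff, Pi.single_eq_same]
      · intro γ hγ i
        simp only [S, coeff_ofCoeff, Pi.single_eq_of_ne hγ.ne]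
        rfl)
  exact ⟨S g, hS g, hg⟩

/-- If the class of `w` vanishes in `Ĝ_{F,Ŝ}`, all coefficients of its image under `Phi` vanish, and
the corrections in all degrees add up to a primitive of `w` in the lattice. -/
theorem jS_injective (h : MvPowerSeries.constantCoeff F = f) (hf : IsolatedSingularity f) : Function.Injective (jS F) := by
  rw [injective_iff_map_eq_zero]
  intro x hx
  obtain ⟨w, rfl⟩ := Submodule.Quotient.mk_surjective _ x
  obtain ⟨η, hη, h0⟩ := exists_diffS_coeff_eq h hf w.2
  refine (Submodule.Quotient.mk_eq_zero _).2 ⟨η, fun i _ => hη i, ?_⟩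
  refine (sub_eq_zero.1 (MvPowerSeries.ext fun α => h0 α fun γ _ => ?_)).symm
  have : (Submodule.Quotient.mk w.1 : GS F) = 0 := hx
  rw [this, map_zero, map_zero]

/-- The leading coefficients of an element of the Brieskorn lattice lie in `Ĥ''_f`. -/
theorem coeffG_mem_range_jf (hf : IsolatedSingularity f)
    {z : GS F} (hz : z ∈ LinearMap.range (jS F)) (α : Fin m →₀ ℕ)
    (hα : ∀ γ < α, coeffG f γ (Phi h z) = 0) :
    coeffG f α (Phi h z) ∈ LinearMap.range (jf f) := by
  obtain ⟨w, hw, rfl⟩ := mk_mem_range_jS.1 hz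
  obtain ⟨η, hη, h0⟩ := exists_diffS_coeff_eq h hf hw
  have hcl : (Submodule.Quotient.mk (w - diffS F η) : GS F) = Submodule.Quotient.mk w :=
    (Submodule.Quotient.eq _).2 ⟨-η, by rw [map_neg]; abel⟩
  rw [← hcl, coeffG_Phi_mk h α _ fun γ hγ => h0 γ fun δ hδ => hα δ (lt_of_le_of_lt hδ hγ)]
  exact mk_mem_range_jf.2 ⟨_, Submodule.sub_mem _ hw (diffS_mem_lattS F hη) α, rfl⟩

/-- Well-founded induction on the exponent: once the coefficients below `α` vanish, the one at `α`
lies both in `Ĥ''_f` and in `N`. -/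
theorem eq_zero_of_mem_seriesG (hf : IsolatedSingularity f) {N : Submodule ℂ (Gf f)}
    (hN : ∀ x ∈ N, x ∈ LinearMap.range (jf f) → x = 0)
    {z : GS F} (hz : z ∈ LinearMap.range (jS F)) (hzN : Phi h z ∈ seriesG m N) :
    Phi h z = 0 := by
  refine coeffG_ext fun α => ?_
  rw [map_zero]
  induction α using (wellFounded_lt (α := Fin m →₀ ℕ)).induction with
  | _ α ih =>
  exact hN _ (mem_seriesG.1 hzN α) (coeffG_mem_range_jf h hf hz α ih)

/-- Successive approximation in `s`. The error at `s^α` is split in `Ĝ_f`, and its component in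
`Ĥ''_f` is absorbed by a term `b s^α` with `b` in the lattice. Under `Phi` this term changes no
coefficient at exponents below `α`, and the one at `α` by exactly the class of `b`. -/
theorem exists_sub_mem_seriesG {N : Submodule ℂ (Gf f)}
    (hN : ∀ x : Gf f, ∃ y ∈ LinearMap.range (jf f), ∃ z ∈ N, x = y + z)
    (g : GS (MvPowerSeries.C f : OxS n m)) :
    ∃ z ∈ LinearMap.range (jS F), g - Phi h z ∈ seriesG m N := by
  let S (w : (Fin m →₀ ℕ) → lattU n) : OxUS n m := ofCoeff fun α => (w α : OxU n)
  have hS : ∀ w, S w ∈ lattS n m := fun w α => (w α).2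
  have hSadd : ∀ w w', S (w + w') = S w + S w' := fun w w' => rfl
  have hmk : ∀ w w' : OxUS n m, (Submodule.Quotient.mk (w + w') : GS F) =
    Submodule.Quotient.mk w + Submodule.Quotient.mk w' := fun _ _ => rfl
  obtain ⟨w, hw⟩ := exists_family_of_step
    (fun α w => coeffG f α (g - Phi h (Submodule.Quotient.mk (S w))) ∈ N)
    (fun α w w' hww hα => by
      have h1 : S w' = S w + S (w' - w) := by rw [← hSadd, add_sub_cancel]
      have hz : ∀ γ ≤ α, MvPowerSeries.coeff γ (S (w' - w)) = 0 := fun γ hγ => by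
        simp only [S, coeff_ofCoeff, Pi.sub_apply]
        rw [hww γ hγ, sub_self]
        rfl
      rw [h1, hmk, map_add, ← sub_sub, map_sub, coeffG_Phi_mk h _ _ fun γ hγ => hz γ hγ.le,
        hz α le_rfl]
      exact (congrArg (· ∈ N) (sub_zero _)).mpr hα) (fun α w _ => by
      intro _
      obtain ⟨y, hy, z, hz, hyz⟩ := hN (coeffG f α (g - Phi h (Submodule.Quotient.mk (S w))))
      obtain ⟨b, hb, rfl⟩ := mk_mem_range_jf.1 hy
      refine ⟨⟨b, hb⟩, ?_⟩
      rw [hSadd, hmk, map_add, ← sub_sub, map_sub, hyz, coeffG_Phi_mk h]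
      · simp only [S, coeff_ofCoeff, Pi.single_eq_same]
        rwa [add_sub_cancel_left]
      · intro γ hγ
        simp only [S, coeff_ofCoeff, Pi.single_eq_of_ne hγ.ne]
        rfl)
  exact ⟨_, mk_mem_range_jS.2 ⟨S w, hS w, rfl⟩, mem_seriesG.2 hw⟩

/-- The kernel of `Ĥ''_{F,Ŝ} → Ω_{F,Ŝ}` is `u Ĥ''_{F,Ŝ}`. -/
theorem exists_jS_eq_uS (x : HS F) (hx : prS F x = 0) : ∃ y, jS F x = uS F (jS F y) := by
  classical
  obtain ⟨w, rfl⟩ := Submodule.Quotient.mk_surjective _ x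
  obtain ⟨g, hg⟩ := (Submodule.Quotient.mk_eq_zero _).1 hx
  let η : Fin (n + 1) → OxUS n m := fun i => emb (g i)
  have hη : ∀ i, η i ∈ lattS n m := fun i α => constU_mem_lattU _
  have h0 : mapCoeffLin (coeffU 0) (w.1 + diffS F η) = 0 := by
    rw [map_add, mapCoeff_diffS F η hη]
    have : (fun i => mapCoeffLin (coeffU 0) (η i)) = g := funext fun i =>
      MvPowerSeries.ext fun α => (coeffU_constU _ 0).trans (if_pos rfl)
    rw [this, hg]
    exact add_neg_cancel _
  have hl : upowS n m (-1) * (w.1 + diffS F η) ∈ lattS n m := fun α k hk => by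
    rw [upowS, MvPowerSeries.coeff_C_mul, coeffU_upow_mul]
    rcases eq_or_ne k (-1) with rfl | hne
    · exact congrArg (MvPowerSeries.coeff α) h0
    · exact (lattS n m).add_mem w.2 (diffS_mem_lattS F hη) α _ (by omega)
  refine ⟨Submodule.Quotient.mk ⟨_, hl⟩, ?_⟩
  change (Submodule.Quotient.mk w.1 : GS F) =
    uS F (uinvS F (Submodule.Quotient.mk (w.1 + diffS F η)))
  rw [uS_uinvS]
  refine ((Submodule.Quotient.eq _).2 ⟨-η, ?_⟩)
  rw [map_neg]
  abel

theorem prS_eq_zero (h : MvPowerSeries.constantCoeff F = f) (hf : IsolatedSingularity f) {x y : HS F}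
    (hxy : jS F x = uS F (jS F y)) : prS F x = 0 := by
  obtain ⟨w, rfl⟩ := Submodule.Quotient.mk_surjective _ y
  have : x = Submodule.Quotient.mk ⟨upowS n m 1 * w.1, upowS_mul_mem_lattS zero_le_one w.2⟩ :=
    jS_injective h hf hxy
  rw [this]
  have h0 : mapCoeffLin (coeffU 0) (upowS n m 1 * w.1) = 0 := MvPowerSeries.ext fun α => by
    rw [mapCoeffLin_apply, coeff_mapCoeff, upowS, MvPowerSeries.coeff_C_mul, coeffU_upow_mul]
    exact w.2 α _ (by norm_num)
  change (Submodule.Quotient.mk (mapCoeffLin (coeffU 0) (upowS n m 1 * w.1)) : OmegaS F) = 0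
  rw [h0]
  rfl

theorem prS_surjective : Function.Surjective (prS F) := by
  intro x
  obtain ⟨v, rfl⟩ := Submodule.Quotient.mk_surjective _ x
  refine ⟨Submodule.Quotient.mk ⟨emb v, fun α => constU_mem_lattU _⟩, ?_⟩
  exact congrArg Submodule.Quotient.mk
    (MvPowerSeries.ext fun α => (coeffU_constU _ 0).trans (if_pos rfl))

theorem coeffG_zero_Phi_jS (x : HS F) : coeffG f 0 (Phi h (jS F x)) = jf f (restr h x) := by
  obtain ⟨w, rfl⟩ := Submodule.Quotient.mk_surjective _ x
  exact coeffG_Phi_mk h 0 _ fun γ hγ => absurd hγ (by simp)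

end Deformation

end Brieskorn

/-! ### Good sections -/

namespace Brieskorn

open LatticeDecomposition

theorem exists_sum_X_mul {τ B : Type*} [CommRing B] (T : Finset τ) (v : MvPowerSeries τ B)
    (hv : ∀ ν : τ →₀ ℕ, (∀ j ∈ T, ν j = 0) → MvPowerSeries.coeff ν v = 0) :
    ∃ g : τ → MvPowerSeries τ B, v = ∑ i ∈ T, MvPowerSeries.X i * g i := by
  classical
  induction T using Finset.induction_on generalizing v with
  | empty => exact ⟨0, by
    rw [Finset.sum_empty]
    exact MvPowerSeries.ext fun ν => (hv ν (by simp)).trans (map_zero _).symm⟩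
  | insert j T hj ih =>
    -- The part of `v` not involving `s_j`; the remainder is divisible by `s_j`.
    let v' : MvPowerSeries τ B := fun ν => if ν j = 0 then MvPowerSeries.coeff ν v else 0
    have hc : ∀ ν, MvPowerSeries.coeff ν v' = if ν j = 0 then MvPowerSeries.coeff ν v else 0 :=
      fun _ => rfl
    obtain ⟨g, hg⟩ := ih v' fun ν hν => by
      rw [hc]
      split_ifs with h0
      · refine hv ν fun k hk => ?_
        rcases Finset.mem_insert.1 hk with rfl | hk
        exacts [h0, hν k hk]
      · rfl
    obtain ⟨q, hq⟩ := MvPowerSeries.X_dvd_iff.2 (show ∀ ν : τ →₀ ℕ, ν j = 0 →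
      MvPowerSeries.coeff ν (v - v') = 0 from fun ν hν => by
        rw [map_sub, hc, if_pos hν, sub_self])
    refine ⟨Function.update g j q, ?_⟩
    rw [Finset.sum_insert hj, Function.update_self, ← hq]
    have : ∑ i ∈ T, MvPowerSeries.X i * Function.update g j q i =
        ∑ i ∈ T, MvPowerSeries.X i * g i := Finset.sum_congr rfl fun i hi => by
      rw [Function.update_of_ne (ne_of_mem_of_not_mem hi hj)]
    rw [this, ← hg, sub_add_cancel]

/-! ### Restriction of sections to `s = 0` -/

section Sections

variable {n m : ℕ} {F : OxS n m} {f : Ox n} (h : MvPowerSeries.constantCoeff F = f)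

theorem jf_restr_mk {w : OxUS n m} (hw : w ∈ lattS n m) :
    jf f (restr h (Submodule.Quotient.mk ⟨w, hw⟩)) =
      Submodule.Quotient.mk (MvPowerSeries.constantCoeff w) := rfl

/-- Since there are finitely many parameters, `v` is a combination of the `s_i`. By
`ℂ[[s]]`-linearity each `s_i` passes through `σ` and is killed by the restriction. Hence the
restriction of `σ` depends only on values at `s = 0`. -/
theorem restr_section_eq_zero (σ : OmegaS F →ₗ[CS m] HS F) (v : OxS n m)
    (hv : MvPowerSeries.constantCoeff v = 0) : restr h (σ (Submodule.Quotient.mk v)) = 0 := by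
  obtain ⟨g, rfl⟩ := exists_sum_X_mul Finset.univ v fun ν hν => by
    have : ν = 0 := Finsupp.ext fun j => hν j (Finset.mem_univ j)
    rw [this]; exact hv
  have h1 : ∀ i, (MvPowerSeries.X i * g i : OxS n m) = (MvPowerSeries.X i : CS m) • g i :=
    fun i => by rw [Algebra.smul_def, MvPowerSeries.algebraMap_apply'', MvPowerSeries.map_X]
  have h2 : (Submodule.Quotient.mk (∑ i, MvPowerSeries.X i * g i) : OmegaS F) =
      ∑ i, (MvPowerSeries.X i : CS m) • Submodule.Quotient.mk (g i) := by
    simp only [h1]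
    exact map_sum (Submodule.mkQ _) _ _
  rw [h2, map_sum, map_sum]
  refine Finset.sum_eq_zero fun i _ => ?_
  rw [map_smul, map_smulₛₗ, MvPowerSeries.constantCoeff_X, zero_smul]

theorem mk_constantCoeff_eq {a b : OxS n m}
    (hab : (Submodule.Quotient.mk a : OmegaS F) = Submodule.Quotient.mk b) :
    (Submodule.Quotient.mk (MvPowerSeries.constantCoeff a) : Omegaf (MvPowerSeries.constantCoeff F))
      = Submodule.Quotient.mk (MvPowerSeries.constantCoeff b) := by
  obtain ⟨η, hη⟩ := (Submodule.Quotient.eq _).1 hab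
  refine (Submodule.Quotient.eq _).2 ⟨fun i => MvPowerSeries.constantCoeff (η i), ?_⟩
  rw [← map_sub, ← hη]
  simp only [wedgeD, LinearMap.coe_mk, AddHom.coe_mk, map_sum, map_mul]
  rfl

theorem prS_mk (w : lattS n m) : prS F (Submodule.Quotient.mk w) =
    Submodule.Quotient.mk (mapCoeffLin (coeffU 0) w.1) := rfl

theorem prf_restr_mk (w : lattS n m) : prf f (restr h (Submodule.Quotient.mk w)) =
    Submodule.Quotient.mk (MvPowerSeries.constantCoeff (mapCoeffLin (coeffU 0) w.1)) := rfl

theorem mk_wedgeD (F : OxS n m) (g : Fin (n + 1) → OxS n m) :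
    (Submodule.Quotient.mk (wedgeD (CS m) (fun i => liftS (pd i) F) g) : OmegaS F) = 0 :=
  (Submodule.Quotient.mk_eq_zero _).2 ⟨g, rfl⟩

/-- The restriction to `s = 0` of a map on `Ω_{F,Ŝ}`, on representatives. -/
noncomputable def restrSection (σ : OmegaS F →ₗ[CS m] HS F) : Ox n →ₗ[ℂ] Hf f where
  toFun v := restr h (σ (Submodule.Quotient.mk (MvPowerSeries.C v)))
  map_add' v w := by rw [map_add, Submodule.Quotient.mk_add, map_add, map_add]
  map_smul' c v := by
    have hC : (MvPowerSeries.C (c • v) : OxS n m) =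
        (MvPowerSeries.C c : CS m) • (MvPowerSeries.C v : OxS n m) := by
      rw [Algebra.smul_def (MvPowerSeries.C c : CS m), MvPowerSeries.algebraMap_apply'',
        MvPowerSeries.map_C, Algebra.smul_def c v, map_mul]
    rw [hC, Submodule.Quotient.mk_smul, map_smul, map_smulₛₗ, MvPowerSeries.constantCoeff_C,
      RingHom.id_apply]

theorem restrSection_apply (σ : OmegaS F →ₗ[CS m] HS F) (v : Ox n) :
    restrSection h σ v = restr h (σ (Submodule.Quotient.mk (MvPowerSeries.C v))) := rfl

theorem restr_section (σ : OmegaS F →ₗ[CS m] HS F) (v : OxS n m) :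
    restr h (σ (Submodule.Quotient.mk v)) =
      restrSection h σ (MvPowerSeries.constantCoeff v) := by
  rw [restrSection_apply, ← sub_eq_zero, ← map_sub, ← map_sub, ← Submodule.Quotient.mk_sub]
  refine restr_section_eq_zero h σ _ ?_
  rw [map_sub, MvPowerSeries.constantCoeff_C, sub_self]

theorem range_wedgeD_le_ker (σ : OmegaS F →ₗ[CS m] HS F) :
    LinearMap.range (wedgeD ℂ fun i => pd i f) ≤ LinearMap.ker (restrSection h σ) := by
  rintro _ ⟨g, rfl⟩
  rw [LinearMap.mem_ker]
  have h1 : MvPowerSeries.constantCoeff (wedgeD (CS m) (fun i => liftS (pd i) F)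
      (fun i => MvPowerSeries.C (g i))) = wedgeD ℂ (fun i => pd i f) g := by
    simp only [wedgeD, LinearMap.coe_mk, AddHom.coe_mk, map_sum, map_mul]
    refine Finset.sum_congr rfl fun i _ => ?_
    rw [MvPowerSeries.constantCoeff_C, ← h]
    rfl
  rw [← h1, ← restr_section, mk_wedgeD, map_zero, map_zero]

theorem prf_restrSection {σ : OmegaS F →ₗ[CS m] HS F} (hσ : prS F ∘ₗ σ = LinearMap.id)
    (v : Ox n) : prf f (restrSection h σ v) = Submodule.Quotient.mk v := by
  subst h
  have h1 := LinearMap.congr_fun hσ (Submodule.Quotient.mk (MvPowerSeries.C v))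
  rw [restrSection_apply]
  rw [LinearMap.comp_apply, LinearMap.id_apply] at h1
  obtain ⟨w, hw⟩ := Submodule.Quotient.mk_surjective _
    (σ (Submodule.Quotient.mk (MvPowerSeries.C v)))
  rw [← hw, prS_mk] at h1
  rw [← hw, prf_restr_mk, mk_constantCoeff_eq h1, MvPowerSeries.constantCoeff_C]

/-- The restriction of a section to `s = 0`. -/
theorem exists_section_restr (σ : OmegaS F →ₗ[CS m] HS F) (hσ : prS F ∘ₗ σ = LinearMap.id) :
    ∃ σ₀ : Omegaf f →ₗ[ℂ] Hf f, prf f ∘ₗ σ₀ = LinearMap.id ∧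
      imZero h σ = (LinearMap.range σ₀).map (jf f) := by
  refine ⟨Submodule.liftQ _ _ (range_wedgeD_le_ker h σ),
    Submodule.linearMap_qext _ (LinearMap.ext fun v => prf_restrSection h hσ v), ?_⟩
  rw [imZero]
  congr 1
  rw [Submodule.range_liftQ]
  refine le_antisymm ?_ ?_
  · rintro _ ⟨_, ⟨x, rfl⟩, rfl⟩
    obtain ⟨v, rfl⟩ := Submodule.Quotient.mk_surjective _ x
    exact ⟨_, (restr_section h σ v).symm⟩
  · rintro _ ⟨v, rfl⟩
    exact ⟨_, LinearMap.mem_range_self σ _, rfl⟩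

/-- The elements of the Brieskorn lattice which correspond to series with coefficients
in `I[u⁻¹]`. -/
noncomputable def constantPart (I : Submodule ℂ (Gf f)) : Submodule (CS m) (HS F) :=
  ((seriesG m (adjoinUinv I)).comap (Phi h)).comap (jS F)

theorem mem_constantPart {I : Submodule ℂ (Gf f)} {x : HS F} :
    x ∈ constantPart h I ↔ ∀ α, coeffG f α (Phi h (jS F x)) ∈ adjoinUinv I := mem_seriesG

theorem map_constantPart (I : Submodule ℂ (Gf f)) :
    (constantPart h I).map (jS F) =
      LinearMap.range (jS F) ⊓ (seriesG m (adjoinUinv I)).map (Psi h) := by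
  ext z
  constructor
  · rintro ⟨x, hx, rfl⟩
    exact ⟨⟨x, rfl⟩, _, hx, Psi_Phi h _⟩
  · rintro ⟨⟨x, rfl⟩, g, hg, hgx⟩
    refine ⟨x, ?_, rfl⟩
    change Phi h (jS F x) ∈ seriesG m (adjoinUinv I)
    rw [← hgx, Phi_Psi]
    exact hg

/-! ### The complement defined by constant series, for a given `I_0` -/

section Frame

variable {I : Submodule ℂ (Gf f)} (hf : IsolatedSingularity f)
  (fr : IsFrame (uf f) (uinvf f) (LinearMap.range (jf f)) I)
include fr

/-- Decompose `u⁻¹ Phi(x)` as `Phi(y)` plus a series with coefficients in `u⁻¹ I[u⁻¹]`, then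
multiply by `u`. -/
theorem exists_constantPart_add (x : HS F) : ∃ j ∈ constantPart h I, ∃ y : HS F,
    jS F x = jS F j + uS F (jS F y) := by
  obtain ⟨_, ⟨y, rfl⟩, hy⟩ := exists_sub_mem_seriesG h fr.exists_add_mem
    (uinvS _ (Phi h (jS F x)))
  obtain ⟨j, hj⟩ := Submodule.sub_mem _ (⟨x, rfl⟩ : jS F x ∈ LinearMap.range (jS F))
    (uS_mem_range_jS (⟨y, rfl⟩ : jS F y ∈ LinearMap.range (jS F)))
  refine ⟨j, (mem_constantPart h).2 fun α => ?_, y, by rw [hj, sub_add_cancel]⟩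
  obtain ⟨a, ha, hae⟩ := mem_seriesG.1 hy α
  have : coeffG f α (Phi h (jS F j)) = uf f (uinvf f a) := by
    rw [hae, ← coeffG_uS, map_sub, uS_uinvS, ← Phi_uS, ← map_sub, hj]
  rw [this, uf_uinvf]
  exact ha

include hf in
-- Dividing by `u` gives an element `y` of the lattice whose series has coefficients in `u⁻¹
-- I[u⁻¹]`; by the directness of the decomposition it vanishes.
theorem eq_zero_of_mem_constantPart {x y : HS F} (hx : x ∈ constantPart h I)
    (hxy : jS F x = uS F (jS F y)) : x = 0 := by
  have h1 : Phi h (jS F y) = 0 := by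
    refine eq_zero_of_mem_seriesG h hf (fun _ => fr.eq_zero_of_mem) ⟨y, rfl⟩
      (mem_seriesG.2 fun α => ⟨_, (mem_constantPart h).1 hx α, ?_⟩)
    rw [← coeffG_uinvS, hxy, Phi_uS, uinvS_uS]
  have h2 : jS F y = 0 := by rw [← Psi_Phi h (jS F y), h1, map_zero]
  refine jS_injective h hf ?_
  rw [hxy, h2, map_zero, map_zero]

include hf in
theorem constantPart_ext {x y : HS F} (hx : x ∈ constantPart h I) (hy : y ∈ constantPart h I)
    (hxy : prS F x = prS F y) : x = y := by
  obtain ⟨z, hz⟩ := exists_jS_eq_uS (x - y) (by rw [map_sub, hxy, sub_self])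
  exact sub_eq_zero.1 (eq_zero_of_mem_constantPart h hf fr (Submodule.sub_mem _ hx hy) hz)

include hf in
-- The constant part is a complement of the kernel `u Ĥ''_F` of the projection, so it maps
-- isomorphically onto `Ω_F`; the section is the inverse map.
theorem exists_section_range_eq : ∃ σ : OmegaS F →ₗ[CS m] HS F,
    prS F ∘ₗ σ = LinearMap.id ∧ LinearMap.range σ = constantPart h I := by
  have hbij : Function.Bijective ((prS F).domRestrict (constantPart h I)) := by
    constructor
    · intro x y hxy
      exact Subtype.ext (constantPart_ext h hf fr x.2 y.2 hxy)
    · intro x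
      obtain ⟨x', rfl⟩ := prS_surjective x
      obtain ⟨j, hj, y, hy⟩ := exists_constantPart_add h fr x'
      refine ⟨⟨j, hj⟩, ?_⟩
      change prS F j = prS F x'
      refine (sub_eq_zero.1 ?_).symm
      rw [← map_sub]
      exact prS_eq_zero h hf (y := y) (by rw [map_sub, hy, add_sub_cancel_left])
  let e := LinearEquiv.ofBijective _ hbij
  refine ⟨(constantPart h I).subtype ∘ₗ e.symm.toLinearMap, ?_, ?_⟩
  · refine LinearMap.ext fun x => ?_
    exact e.apply_symm_apply x
  · rw [LinearMap.range_comp, LinearEquiv.range, Submodule.map_top, Submodule.range_subtype]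

theorem imZero_of_range_eq (σ : OmegaS F →ₗ[CS m] HS F)
    (hσ : LinearMap.range σ = constantPart h I) : imZero h σ = I := by
  have hle : ∀ x ∈ constantPart h I, jf f (restr h x) ∈ I := fun x hx => by
    refine fr.mem_of_mem_adjoin ?_ ⟨_, rfl⟩
    rw [← coeffG_zero_Phi_jS]
    exact (mem_constantPart h).1 hx 0
  rw [imZero, hσ]
  refine le_antisymm ?_ fun a ha => ?_
  · rintro _ ⟨_, ⟨x, hx, rfl⟩, rfl⟩
    exact hle x hx
  · obtain ⟨w, hw, rfl⟩ := mk_mem_range_jf.1 (fr.le ha)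
    have hwS : (MvPowerSeries.C w : OxUS n m) ∈ lattS n m := fun α => by
      classical
      rw [MvPowerSeries.coeff_C]
      split_ifs
      exacts [hw, Submodule.zero_mem _]
    let x : HS F := Submodule.Quotient.mk ⟨_, hwS⟩
    have hx : jf f (restr h x) = Submodule.Quotient.mk w := by
      rw [jf_restr_mk, MvPowerSeries.constantCoeff_C]
    obtain ⟨j, hj, y, hy⟩ := exists_constantPart_add h fr x
    have h0 : (Submodule.Quotient.mk w : Gf f) =
        jf f (restr h j) + uf f (jf f (restr h y)) := by
      rw [← hx, ← coeffG_zero_Phi_jS, hy, map_add, map_add, Phi_uS, coeffG_uS,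
        coeffG_zero_Phi_jS, coeffG_zero_Phi_jS]
    -- At `s = 0` the decomposition reads `a = j_0 + u y_0` with `a` and `j_0` in `I`. So `u y_0`
    -- lies in both `I` and `u Ĥ''_f`, and `y_0 = 0`.
    have h1 : jf f (restr h y) = 0 := by
      refine fr.eq_zero _ ⟨_, rfl⟩ ?_
      rw [← add_sub_cancel_left (jf f (restr h j)) (uf f _), ← h0]
      exact Submodule.sub_mem _ ha (hle j hj)
    rw [h1, map_zero, add_zero] at h0
    rw [h0]
    exact ⟨_, ⟨j, hj, rfl⟩, rfl⟩

/-- The lattice is stable under `u ∂_{s_i}`, so `u ∂_{s_i} x = j + u k` with `j` in the constant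
part and `k` in the lattice. Then `k = ∂_{s_i} x - u⁻¹ j` also has its series in `I[u⁻¹][[s]]`,
which is closed under `∂_{s_i}` and `u⁻¹`. -/
theorem dsS_mem_of_range_eq (σ : OmegaS F →ₗ[CS m] HS F)
    (hσ : LinearMap.range σ = constantPart h I) (i : Fin m) (w : GS F) (hw : w ∈ imS σ) :
    dsS F i w ∈ imS σ ⊔ (imS σ).map (uinvS F) := by
  rw [imS, hσ] at *
  obtain ⟨x, hx, rfl⟩ := hw
  obtain ⟨y, hy⟩ := uS_dsS_mem_range_jS i (⟨x, rfl⟩ : jS F x ∈ LinearMap.range (jS F))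
  obtain ⟨j, hj, k, hk⟩ := exists_constantPart_add h fr y
  have h1 : dsS F i (jS F x) = jS F k + uinvS F (jS F j) := by
    rw [← uinvS_uS F (dsS F i (jS F x)), ← hy, hk, map_add, uinvS_uS, add_comm]
  rw [h1]
  refine Submodule.add_mem_sup ⟨k, (mem_constantPart h).2 fun α => ?_, rfl⟩ ⟨_, ⟨j, hj, rfl⟩, rfl⟩
  have h2 : jS F k = dsS F i (jS F x) - uinvS F (jS F j) := by rw [h1, add_sub_cancel_right]
  rw [h2, map_sub, map_sub, Phi_dsS, Phi_uinvS, coeffG_dsS, coeffG_uinvS]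
  refine Submodule.sub_mem _ (Submodule.smul_mem _ _ ((mem_constantPart h).1 hx _)) ?_
  exact map_adjoin_le _ _ ⟨_, (mem_constantPart h).1 hj α, rfl⟩

end Frame

/-- As `∂_{s_i}` commutes with `u⁻¹`, admissibility propagates from `I_Ŝ` to every `u^{-k} I_Ŝ`. -/
theorem IsGoodSection.dsS_mem_adjoin {σ : OmegaS F →ₗ[CS m] HS F} (hσ : IsGoodSection σ)
    (i : Fin m) {z : GS F} (hz : z ∈ adjoin (uinvS F) (imS σ)) :
    dsS F i z ∈ adjoin (uinvS F) (imS σ) := by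
  have hstable : ∀ (k : ℕ) (y : GS F), y ∈ adjoin (uinvS F) (imS σ) →
      (uinvS F ^ k) y ∈ adjoin (uinvS F) (imS σ) := fun k y hy => by
    induction k with
    | zero => exact hy
    | succ k ih =>
      rw [pow_succ', Module.End.mul_apply]
      exact map_adjoin_le _ _ ⟨_, ih, rfl⟩
  have hcomm : ∀ (k : ℕ) (y : GS F), dsS F i ((uinvS F ^ k) y) = (uinvS F ^ k) (dsS F i y) :=
    fun k y => by
      induction k with
      | zero => rfl
      | succ k ih => rw [pow_succ', Module.End.mul_apply, Module.End.mul_apply, dsS_uinvS, ih]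
  refine Submodule.iSup_induction _ (motive := fun z => dsS F i z ∈ adjoin (uinvS F) (imS σ)) hz
    ?_ ?_ ?_
  · rintro k _ ⟨y, hy, rfl⟩
    rw [hcomm]
    refine hstable k _ ?_
    have h1 := hσ.2 i y hy
    have h2 : imS σ ⊔ (imS σ).map (uinvS F) ≤ adjoin (uinvS F) (imS σ) := sup_le (le_adjoin _ _)
      ((Submodule.map_mono (le_adjoin _ _)).trans (map_adjoin_le _ _))
    exact h2 h1
  · rw [map_zero]; exact Submodule.zero_mem _
  · intro x y hx hy
    rw [map_add]; exact Submodule.add_mem _ hx hy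

/-- Taylor's formula by induction on `α`, for all `z` at once. The coefficient of `∂_{s_i} z` at `β`
is `β_i + 1` times that of `z` at `β + e_i`, and this factor is invertible. The case `α = 0` is the
restriction to `s = 0`. -/
theorem IsGoodSection.coeffG_mem {σ : OmegaS F →ₗ[CS m] HS F} (hσ : IsGoodSection σ)
    (α : Fin m →₀ ℕ) {z : GS F} (hz : z ∈ adjoin (uinvS F) (imS σ)) :
    coeffG f α (Phi h z) ∈ adjoinUinv (imZero h σ) := by
  induction α using (wellFounded_lt (α := Fin m →₀ ℕ)).induction generalizing z with
  | _ α ih =>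
  by_cases hα : α = 0
  · subst hα
    refine Submodule.iSup_induction _
      (motive := fun z => coeffG f 0 (Phi h z) ∈ adjoinUinv (imZero h σ)) hz ?_ ?_ ?_
    · rintro k _ ⟨_, ⟨y, hy, rfl⟩, rfl⟩
      have h1 : coeffG f 0 (Phi h ((uinvS F ^ k) (jS F y))) =
          (uinvf f ^ k) (jf f (restr h y)) := by
        induction k with
        | zero => exact coeffG_zero_Phi_jS h y
        | succ k ihk =>
          rw [pow_succ', Module.End.mul_apply, Phi_uinvS, coeffG_uinvS, ihk, pow_succ',
            Module.End.mul_apply]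
      rw [h1]
      exact (le_iSup (fun k : ℕ => (imZero h σ).map (uinvf f ^ k)) k)
        ⟨_, ⟨_, ⟨y, hy, rfl⟩, rfl⟩, rfl⟩
    · rw [map_zero, map_zero]; exact Submodule.zero_mem _
    · intro x y hx hy
      rw [map_add, map_add]; exact Submodule.add_mem _ hx hy
  · obtain ⟨i, hi⟩ := Finsupp.ne_iff.1 hα
    have hle : Finsupp.single i 1 ≤ α := Finsupp.single_le_iff.2 (Nat.one_le_iff_ne_zero.2 hi)
    obtain ⟨β, rfl⟩ : ∃ β, α = β + Finsupp.single i 1 :=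
      ⟨α - Finsupp.single i 1, (tsub_add_cancel_of_le hle).symm⟩
    have h1 := ih β (lt_add_of_pos_right _ (by
      rw [pos_iff_ne_zero]; simp)) (hσ.dsS_mem_adjoin i hz)
    rw [Phi_dsS, coeffG_dsS] at h1
    exact ((adjoinUinv (imZero h σ)).smul_mem_iff (Nat.cast_add_one_ne_zero _)).1 h1

/-- One inclusion is `IsGoodSection.coeffG_mem`. It is an equality because the image of `σ` already
meets every fibre of the projection, while elements of the constant part are determined by their
projections. -/
theorem IsGoodSection.range_eq (hf : IsolatedSingularity f) {σ : OmegaS F →ₗ[CS m] HS F}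
    (hσ : IsGoodSection σ)
    (fr : IsFrame (uf f) (uinvf f) (LinearMap.range (jf f)) (imZero h σ)) :
    LinearMap.range σ = constantPart h (imZero h σ) := by
  have hle : LinearMap.range σ ≤ constantPart h (imZero h σ) := fun x hx =>
    (mem_constantPart h).2 fun α => hσ.coeffG_mem h α (le_adjoin _ _ ⟨x, hx, rfl⟩)
  refine le_antisymm hle fun x hx => ?_
  have := constantPart_ext h hf fr hx (hle ⟨prS F x, rfl⟩)
    (LinearMap.congr_fun hσ.1 (prS F x)).symm
  exact ⟨_, this.symm⟩

end Sections

end Brieskorn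

/-! ### The theorem -/

theorem theorem1p4 (n m : ℕ) (f : Ox n) (hf : IsolatedSingularity f)
    (F : Conv (Fin (n + 1) ⊕ Fin m)) (hF : MvPowerSeries.constantCoeff (expand F) = f) :
    -- the Brieskorn lattices are contained in the Gauss-Manin systems
    Function.Injective (jf f) ∧ Function.Injective (jS (expand F)) ∧
    -- the explicit formula for the image of a section in terms of its restriction to `s = 0`,
    -- which is the image of a section of `Ĥ''_f → Ω_f`
    (∀ σ : OmegaS (expand F) →ₗ[CS m] HS (expand F), IsGoodSection σ →
      imS σ = LinearMap.range (jS (expand F)) ⊓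
        (seriesG m (adjoinUinv (imZero hF σ))).map (Psi hF) ∧
      ∃ σ₀ : Omegaf f →ₗ[ℂ] Hf f, prf f ∘ₗ σ₀ = LinearMap.id ∧
        imZero hF σ = (LinearMap.range σ₀).map (jf f)) ∧
    -- uniqueness
    (∀ σ σ' : OmegaS (expand F) →ₗ[CS m] HS (expand F), IsGoodSection σ → IsGoodSection σ' →
      imZero hF σ = imZero hF σ' → σ = σ') ∧
    -- the decomposition, and existence
    (∀ σ₀ : Omegaf f →ₗ[ℂ] Hf f, prf f ∘ₗ σ₀ = LinearMap.id →
      IsCompl ((LinearMap.range (jS (expand F))).map (Phi hF))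
        (seriesG m ((adjoinUinv ((LinearMap.range σ₀).map (jf f))).map (uinvf f))) ∧
      ∃ σ : OmegaS (expand F) →ₗ[CS m] HS (expand F), IsGoodSection σ ∧
        imZero hF σ = (LinearMap.range σ₀).map (jf f)) := by
  have frame : ∀ σ : OmegaS (expand F) →ₗ[CS m] HS (expand F), IsGoodSection σ →
      LatticeDecomposition.IsFrame (uf f) (uinvf f) (LinearMap.range (jf f)) (imZero hF σ) := by
    intro σ hσ
    obtain ⟨σ₀, h1, h2⟩ := exists_section_restr hF σ hσ.1
    rw [h2]
    exact isFrame_of_section hf σ₀ h1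
  refine ⟨jf_injective hf, jS_injective hF hf, fun σ hσ => ⟨?_, exists_section_restr hF σ hσ.1⟩,
    fun σ σ' hσ hσ' h0 => ?_, fun σ₀ hσ₀ => ⟨?_, ?_⟩⟩
  · rw [← map_constantPart, ← hσ.range_eq hF hf (frame σ hσ)]
    rfl
  · have h1 := hσ.range_eq hF hf (frame σ hσ)
    have h2 := hσ'.range_eq hF hf (frame σ' hσ')
    rw [← h0] at h2
    refine LinearMap.ext fun x => ?_
    -- Both values lie in the same constant part and have the same projection to `Ω_F`.
    exact constantPart_ext hF hf (frame σ hσ) (h1 ▸ ⟨x, rfl⟩) (h2 ▸ ⟨x, rfl⟩)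
      ((LinearMap.congr_fun hσ.1 x).trans (LinearMap.congr_fun hσ'.1 x).symm)
  · have fr := isFrame_of_section hf σ₀ hσ₀
    constructor
    · rw [Submodule.disjoint_def]
      rintro _ ⟨z, hz, rfl⟩ hzN
      exact eq_zero_of_mem_seriesG hF hf (fun _ => fr.eq_zero_of_mem) hz hzN
    · rw [codisjoint_iff, eq_top_iff]
      intro g _
      obtain ⟨z, hz, hg⟩ := exists_sub_mem_seriesG hF fr.exists_add_mem g
      rw [← add_sub_cancel (Phi hF z) g]
      exact Submodule.add_mem_sup ⟨z, hz, rfl⟩ hg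
  · have fr := isFrame_of_section hf σ₀ hσ₀
    obtain ⟨σ, h1, h2⟩ := exists_section_range_eq hF hf fr
    exact ⟨σ, ⟨h1, dsS_mem_of_range_eq hF fr σ h2⟩, imZero_of_range_eq hF fr σ h2⟩
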